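/- Let $D$ be a connected (in particular non-empty) oriented alternating classical link diagram, that is, a connected alternating virtual link diagram of supporting genus $g=0$. Here "alternating" means that over- and under-crossings alternate as one travels around each component, and crossingless components are allowed. Then $D$ is checkerboard colorable, and all its checkerboard colorings $\xi$ have the same signature $\sigma_\xi(D)=\sigma$. The rational Khovanov homology of $D$ is supported on two lines ($D$ is $H$-thin): for all $i,j\in\mathbb Z$, $$Kh^{i,j}(D)\neq 0\quad\Longrightarrow\quad j=2i-\sigma+1\ \text{ or }\ j=2i-\sigma-1 .$$ Here $i$ is the homological and $j$ the quantum degree, with $V=\mathbb Q\mathbf 1\oplus\mathbb QX$, $\deg\mathbf 1=1$, $\deg X=-1$. The state $\alpha$ with $r_\alpha$ $1$-smoothings and $k_\alpha$ cycles contributes $V^{\otimes k_\alpha}\{r_\alpha+n_+-2n_-\}$ in homological degree $r_\alpha-n_-$, where $n_\pm$ is the number of positive, respectively negative, crossings. The signature is $\sigma_\xi(D)=\operatorname{sig}(G_\xi(D))-\mu_\xi(D)$. In this formula $G_\xi(D)$ is the Goeritz matrix of the white regions $X_0,\dots,X_m$: it is $(g_{ij})_{1\le i,j\le m}$ with $g_{ij}=-\sum\eta(c)$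 over the crossings $c$ adjacent to both $X_i$ and $X_j$ for $i\ne j$, and $g_{ii}=-\sum_{k\ne i}g_{ik}$. The incidence $\eta(c)$ is $+1$ if the black regions at $c$ are those swept out by turning the upper strand counterclockwise, and $-1$ otherwise. The correction term $\mu_\xi(D)$ is the sum of $\eta(c)$ over the crossings $c$ with $\varepsilon(c)\eta(c)=1$, where $\varepsilon(c)$ is the writhe of $c$. (So $\sigma=-2$ for the positive trefoil.) -/

import Mathlib

/-!
Oriented link diagrams are described combinatorially, by planar-diagram codes. At every crossing the
four half-edges are numbered `0, 1, 2, 3` counterclockwise, starting with the incoming end of the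
lower strand. So `0 → 2` is the lower strand, and `1`, `3` are the two ends of the upper strand.
-/

open scoped Classical in
/-- The signature of a symmetric integral matrix: the number of its positive eigenvalues minus the
number of its negative eigenvalues (with multiplicities). -/
noncomputable def symmSignature {ι : Type} [Fintype ι] (A : Matrix ι ι ℤ) (hA : A.IsSymm) : ℤ :=
  have hH : (A.map (fun x : ℤ => (x : ℝ))).IsHermitian := by
    ext i j
    simp [Matrix.conjTranspose_apply, hA.apply]
  (Nat.card {i : ι // 0 < hH.eigenvalues i} : ℤ) - (Nat.card {i : ι // hH.eigenvalues i < 0} : ℤ)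

/-- The orientation of the half-edges: `true` if the half-edge points away from its crossing. The
upper strand runs `3 → 1` at a positive crossing and `1 → 3` at a negative crossing. -/
def halfEdgeOut {n : ℕ} (positive : Fin n → Bool) (h : Fin n × Fin 4) : Bool :=
  match h.2 with
  | 0 => false
  | 1 => positive h.1
  | 2 => true
  | 3 => !positive h.1

/-- An oriented link diagram on a closed oriented surface whose regions are discs (that is, the
abstract link diagram of a virtual link diagram, capped off): `n` ordered crossings with
their signs, the pairing `mate` that joins the half-edges to the edges of the diagram, and a number
of components without crossings. Each component without crossings lies on a sphere of its own. -/
structure LinkDiagram where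
  n : ℕ
  loops : ℕ
  positive : Fin n → Bool
  mate : Fin n × Fin 4 → Fin n × Fin 4
  mate_mate : ∀ h, mate (mate h) = h
  out_mate : ∀ h, halfEdgeOut positive (mate h) = !halfEdgeOut positive h

namespace LinkDiagram

variable (D : LinkDiagram)

abbrev HalfEdge : Type := Fin D.n × Fin 4

/-- The writhe `ε(c)` of a crossing. -/
def writhe (c : Fin D.n) : ℤ := if D.positive c then 1 else -1

/-- The number `n₊` of positive crossings. -/
def nPos : ℕ := (Finset.univ.filter fun c => D.positive c = true).card

/-- The number `n₋` of negative crossings. -/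
def nNeg : ℕ := (Finset.univ.filter fun c => D.positive c = false).card

/-! ### Connected, alternating and classical diagrams -/

/-- Two half-edges at the same crossing or on the same edge. -/
def linked (h h' : D.HalfEdge) : Prop := h' = D.mate h ∨ h'.1 = h.1

/-- The diagram is connected as a subset of the surface (and is not empty). -/
def Connected : Prop := Nat.card (Quot D.linked ⊕ Fin D.loops) = 1

/-- Half-edges of the upper strand. -/
def isUpper (h : D.HalfEdge) : Bool := h.2 = 1 || h.2 = 3

/-- Each edge of the diagram runs from an over-crossing to an under-crossing or conversely. -/
def Alternating : Prop := ∀ h : D.HalfEdge, D.isUpper (D.mate h) ≠ D.isUpper h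

/-- The corner counterclockwise after the half-edge `h` is, along the edge of `h` and on the left
of it, followed by the corner clockwise before `mate h`. -/
def cornerStep (h h' : D.HalfEdge) : Prop := h' = ((D.mate h).1, (D.mate h).2 - 1)

/-- The regions of the diagram: cycles of corners, and the two sides of each component without
crossings. -/
abbrev Face : Type := Quot D.cornerStep ⊕ (Fin D.loops × Bool)

/-- The region that contains the corner between `h` and the next half-edge counterclockwise. -/
def corner (h : D.HalfEdge) : D.Face := Sum.inl (Quot.mk _ h)

noncomputable instance : Fintype D.Face := Fintype.ofFinite _

/-- The Euler characteristic of the surface of the diagram: `n` vertices, `2 n` edges and the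
regions (a circle without vertices contributes `0`, its two sides contribute `2`). -/
noncomputable def eulerChar : ℤ := (D.n : ℤ) - 2 * (D.n : ℤ) + (Fintype.card D.Face : ℤ)

/-- A connected diagram has supporting genus `g` if its surface has Euler characteristic
`2 - 2 g`. It is a classical diagram, that is a diagram on the sphere, if `g = 0`. -/
def HasGenus (g : ℕ) : Prop := D.eulerChar = 2 - 2 * (g : ℤ)

/-! ### Checkerboard colorings, Goeritz matrices and signatures -/

/-- A coloring of the regions, white (`true`) or black (`false`), in which any two regions that
share an edge have different colors. -/
structure Coloring where
  white : D.Face → Bool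
  edge_ne : ∀ h : D.HalfEdge, white (D.corner h) ≠ white (D.corner (h.1, h.2 - 1))
  loop_ne : ∀ l : Fin D.loops, white (Sum.inr (l, true)) ≠ white (Sum.inr (l, false))

variable {D}

abbrev WhiteRegion (ξ : D.Coloring) : Type := {f : D.Face // ξ.white f = true}

noncomputable instance (ξ : D.Coloring) : Fintype (WhiteRegion ξ) := Fintype.ofFinite _

/-- The incidence number `η(c)`: it is `+1` (type A) if the white regions at `c` are those of the
corners between `0` and `1` and between `2` and `3`, so that the black regions are those swept out
when the upper strand is turned counterclockwise; otherwise it is `-1` (type B). -/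
def incidence (ξ : D.Coloring) (c : Fin D.n) : ℤ := if ξ.white (D.corner (c, 0)) then 1 else -1

/-- The crossing `c` is adjacent to the region `f`. -/
def Adjacent (c : Fin D.n) (f : D.Face) : Prop := ∃ k : Fin 4, D.corner (c, k) = f

open scoped Classical in
/-- The number `- ∑ η(c)`, over all crossings `c` adjacent to both `X` and `Y`. -/
noncomputable def goeritzOff (ξ : D.Coloring) (X Y : WhiteRegion ξ) : ℤ :=
  -∑ c ∈ Finset.univ.filter (fun c => Adjacent c X.1 ∧ Adjacent c Y.1), incidence ξ c

open scoped Classical in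
noncomputable def preGoeritz (ξ : D.Coloring) : Matrix (WhiteRegion ξ) (WhiteRegion ξ) ℤ :=
  fun X Y => if X = Y then -∑ Z ∈ Finset.univ.erase X, goeritzOff ξ X Z else goeritzOff ξ X Y

/-- The Goeritz matrix: the row and the column of the white region `X₀` are removed. -/
noncomputable def goeritz (ξ : D.Coloring) (X₀ : WhiteRegion ξ) :
    Matrix {X : WhiteRegion ξ // X ≠ X₀} {X : WhiteRegion ξ // X ≠ X₀} ℤ :=
  (preGoeritz ξ).submatrix Subtype.val Subtype.val

theorem goeritz_isSymm (ξ : D.Coloring) (X₀ : WhiteRegion ξ) : (goeritz ξ X₀).IsSymm := by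
  have h : ∀ X Y, goeritzOff ξ X Y = goeritzOff ξ Y X := fun X Y => by
    unfold goeritzOff
    congr 2
    ext c
    simp [and_comm]
  ext X Y
  simp only [goeritz, preGoeritz, Matrix.transpose_apply, Matrix.submatrix_apply]
  by_cases e : X.1 = Y.1
  · rw [e]
  · rw [if_neg e, if_neg (Ne.symm e), h]

open scoped Classical in
/-- The correction term: the sum of `η(c)` over the crossings of type II, that is those with
`ε(c) η(c) = 1`. -/
noncomputable def correction (ξ : D.Coloring) : ℤ :=
  ∑ c ∈ Finset.univ.filter (fun c => D.writhe c * incidence ξ c = 1), incidence ξ c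

open scoped Classical in
/-- The signature `σ_ξ(D) = sig(G_ξ(D)) - μ_ξ(D)`. -/
noncomputable def signature (ξ : D.Coloring) (X₀ : WhiteRegion ξ) : ℤ :=
  symmSignature (goeritz ξ X₀) (goeritz_isSymm ξ X₀) - correction ξ

/-! ### Khovanov homology with rational coefficients -/

variable (D)

/-- A state: the choice of the `0`-smoothing (`false`) or `1`-smoothing (`true`) at each crossing. -/
abbrev State : Type := Fin D.n → Bool

/-- The arcs of the smoothed crossings: `0—1` and `2—3` in the `0`-smoothing, `1—2` and `3—0` in the
`1`-smoothing. (So the `0`-smoothing agrees with the orientation at positive crossings, and the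
`1`-smoothing at negative ones.) -/
def smoothArc (α : D.State) (h : D.HalfEdge) : D.HalfEdge :=
  match α h.1, h.2 with
  | false, 0 => (h.1, 1)
  | false, 1 => (h.1, 0)
  | false, 2 => (h.1, 3)
  | false, 3 => (h.1, 2)
  | true, 0 => (h.1, 3)
  | true, 1 => (h.1, 2)
  | true, 2 => (h.1, 1)
  | true, 3 => (h.1, 0)

def stateStep (α : D.State) (h h' : D.HalfEdge) : Prop := h' = D.mate h ∨ h' = D.smoothArc α h

/-- The cycles of a state. -/
abbrev Cycle (α : D.State) : Type := Quot (D.stateStep α) ⊕ Fin D.loops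

noncomputable instance (α : D.State) : Fintype (D.Cycle α) := Fintype.ofFinite _

/-- The cycle through a half-edge. -/
def cyc (α : D.State) (h : D.HalfEdge) : D.Cycle α := Sum.inl (Quot.mk _ h)

/-- The standard basis of the Khovanov complex: a state `α` with a label `1` (`true`) or `X`
(`false`) for each of its cycles. For fixed `α` these are the standard basis vectors of the tensor
power of `V = ℚ 1 ⊕ ℚ X` over the cycles of `α`. -/
abbrev EnhancedState : Type := Σ α : D.State, (D.Cycle α → Bool)

variable {D}

/-- The number of `1`-smoothings. -/
def ones (α : D.State) : ℕ := (Finset.univ.filter fun c => α c = true).card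

/-- The homological degree. -/
def hDeg (S : D.EnhancedState) : ℤ := (ones S.1 : ℤ) - (D.nNeg : ℤ)

/-- The quantum degree; `1` has degree `1` and `X` has degree `-1`. -/
noncomputable def qDeg (S : D.EnhancedState) : ℤ :=
  (∑ z, if S.2 z then (1 : ℤ) else -1) + (ones S.1 : ℤ) + (D.nPos : ℤ) - 2 * (D.nNeg : ℤ)

/-- The coefficient of `c` in `m (a ⊗ b)`. -/
def mulCoeff : Bool → Bool → Bool → ℚ
  | true, true, true => 1
  | true, false, false => 1
  | false, true, false => 1
  | _, _, _ => 0

/-- The coefficient of `b ⊗ c` in `Δ a`. -/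
def comulCoeff : Bool → Bool → Bool → ℚ
  | true, true, false => 1
  | true, false, true => 1
  | false, false, false => 1
  | _, _, _ => 0

/-- The labels of `S` and `T` agree on all cycles of `S` that do not pass through the crossing `m`. -/
def AgreeAway (m : Fin D.n) (S T : D.EnhancedState) : Prop :=
  (∀ h : D.HalfEdge, D.cyc S.1 h ≠ D.cyc S.1 (m, 0) → D.cyc S.1 h ≠ D.cyc S.1 (m, 2) →
      S.2 (D.cyc S.1 h) = T.2 (D.cyc T.1 h)) ∧
    ∀ l : Fin D.loops, S.2 (Sum.inr l) = T.2 (Sum.inr l)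

open scoped Classical in
/-- The part at the crossing `m` of the coefficient of `T` in the differential of `S`. It is nonzero
only if the state of `T` arises from that of `S` when the smoothing of `m` changes from `0` to `1`.
Then two cycles merge (product), or one cycle splits (coproduct), or, which does not happen for
classical diagrams, one cycle is sent to one cycle (zero map). The sign is given by the number of
`1`-smoothings before `m`. -/
noncomputable def edgeCoeff (m : Fin D.n) (S T : D.EnhancedState) : ℚ :=
  if S.1 m = false ∧ T.1 = Function.update S.1 m true ∧ AgreeAway m S T then
    (-1) ^ (Finset.univ.filter fun c => c < m ∧ S.1 c = true).card *
      (if D.cyc S.1 (m, 0) ≠ D.cyc S.1 (m, 2) then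
        mulCoeff (S.2 (D.cyc S.1 (m, 0))) (S.2 (D.cyc S.1 (m, 2))) (T.2 (D.cyc T.1 (m, 0)))
      else if D.cyc T.1 (m, 0) ≠ D.cyc T.1 (m, 2) then
        comulCoeff (S.2 (D.cyc S.1 (m, 0))) (T.2 (D.cyc T.1 (m, 0))) (T.2 (D.cyc T.1 (m, 2)))
      else 0)
  else 0

variable (D)

/-- The basis of the chain group in homological degree `i` and quantum degree `j`. -/
abbrev Gen (i j : ℤ) : Type := {S : D.EnhancedState // hDeg S = i ∧ qDeg S = j}

noncomputable instance (i j : ℤ) : Fintype (D.Gen i j) := Fintype.ofFinite _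

/-- The chain group `C^{i,j}(D)`. -/
abbrev Chain (i j : ℤ) : Type := D.Gen i j → ℚ

/-- The component `C^{i,j}(D) → C^{i',j}(D)` of the differential. Only `i' = i + 1` matters: all
other components vanish. -/
noncomputable def diff (i i' j : ℤ) : D.Chain i j →ₗ[ℚ] D.Chain i' j :=
  Matrix.mulVecLin (Matrix.of fun (T : D.Gen i' j) (S : D.Gen i j) => ∑ m, edgeCoeff m S.1 T.1)

/-- The Khovanov homology `Kh^{i,j}(D)` of a classical diagram: cycles modulo boundaries. -/
abbrev Kh (i j : ℤ) : Type :=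
  LinearMap.ker (D.diff i (i + 1) j) ⧸
    (LinearMap.range (D.diff (i - 1) i j)).submoduleOf (LinearMap.ker (D.diff i (i + 1) j))

end LinkDiagram

/-!
The proof works with the cube of resolutions of the fixed diagram. Smoothing some of the crossings
is described by a subcube of the cube, and no new diagrams are formed.

*Combinatorics.* In an alternating diagram the half-edges of the lower and of the upper strands
alternate along every cycle of every state. Hence a change of one smoothing never turns one
cycle into one cycle, but merges two cycles or splits one (`rel_toggle`). Therefore the faces of the
cube commute (`edgeMap_comm`), and a subcube of dimension `u` whose partially smoothed diagram
has `c` components satisfies `k₀ + k₁ ≤ u + 2 c`, where `k₀` and `k₁` are the numbers of cycles of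
its two extreme states (`cycleCount_add_le`). For the full cube of a connected diagram on the
sphere, `k₀ + k₁ = n + 2`, as the cycles of the two extreme states correspond to the regions of the
two colors (`regionOf`, `cycleCount_add_cycleCount`).

*Thinness.* Let `δ` be the degree minus the number of `1`-smoothings. For every connected
subcube with `k₀ + k₁ = u + 2`, the homology lives in the two degrees `δ = -k₀ - r₀` and
`δ = 2 - k₀ - r₀`, where `r₀` is the number of `1`-smoothings of the lowest state. This is proved by
induction on `u` (`exactAt_of_connected`). If both smoothings of a crossing are connected, then both
satisfy the hypothesis with the same two values of `δ`, and the long exact sequence of the crossing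
applies (`exactAt_of_faces`). If one smoothing is disconnected, the edge maps between its complex and
the complex of the other, connected smoothing are the product `V ⊗ V → V` and the coproduct
`V → V ⊗ V`, and after a sign twist on one component (`twist`) they form a short exact sequence of
complexes. So the homology of the subcube is that of the connected smoothing
(`exactAt_of_not_compRel_false`, `exactAt_of_not_compRel_true`).

*Signature.* The incidence number is the same at all crossings. So the Goeritz matrix is, up to this
sign, the reduced Laplacian of the connected graph of white regions, hence definite, and
the signature is `k₀ - 1 - n₊` for every coloring (`signature_eq`).
-/

/-! ### Gluing two classes of an equivalence relation -/

namespace Setoid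

variable {β : Type}

/-- The finest equivalence relation that contains `s` and relates `a` to `b`. -/
def glue (s : Setoid β) (a b : β) : Setoid β where
  r x y := s x y ∨ (s x a ∧ s b y) ∨ (s x b ∧ s a y)
  iseqv := by
    refine ⟨fun x => Or.inl (s.refl x), ?_, ?_⟩
    · rintro x y (h | ⟨h, h'⟩ | ⟨h, h'⟩)
      · exact Or.inl (s.symm h)
      · exact Or.inr (Or.inr ⟨s.symm h', s.symm h⟩)
      · exact Or.inr (Or.inl ⟨s.symm h', s.symm h⟩)
    · rintro x y z (h | ⟨h, h'⟩ | ⟨h, h'⟩) (k | ⟨k, k'⟩ | ⟨k, k'⟩)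
      · exact Or.inl (s.trans h k)
      · exact Or.inr (Or.inl ⟨s.trans h k, k'⟩)
      · exact Or.inr (Or.inr ⟨s.trans h k, k'⟩)
      · exact Or.inr (Or.inl ⟨h, s.trans h' k⟩)
      · exact Or.inr (Or.inl ⟨h, k'⟩)
      · exact Or.inl (s.trans h k')
      · exact Or.inr (Or.inr ⟨h, s.trans h' k⟩)
      · exact Or.inl (s.trans h k')
      · exact Or.inr (Or.inr ⟨h, k'⟩)

theorem glue_apply {s : Setoid β} {a b x y : β} :
    s.glue a b x y ↔ s x y ∨ (s x a ∧ s b y) ∨ (s x b ∧ s a y) := Iff.rfl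

theorem le_glue (s : Setoid β) (a b : β) : s ≤ s.glue a b := fun _ _ h => Or.inl h

theorem glue_pair (s : Setoid β) (a b : β) : s.glue a b a b :=
  Or.inr (Or.inl ⟨s.refl a, s.refl b⟩)

theorem glue_le {s t : Setoid β} {a b : β} (h : s ≤ t) (hab : t a b) : s.glue a b ≤ t := by
  rintro x y (k | ⟨k, k'⟩ | ⟨k, k'⟩)
  · exact h k
  · exact t.trans (h k) (t.trans hab (h k'))
  · exact t.trans (h k) (t.trans (t.symm hab) (h k'))

theorem glue_eq_self {s : Setoid β} {a b : β} (h : s a b) : s.glue a b = s :=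
  le_antisymm (glue_le le_rfl h) (le_glue s a b)

theorem card_glue [Finite β] {s : Setoid β} {a b : β} (h : ¬ s a b) :
    Nat.card (Quotient (s.glue a b)) + 1 = Nat.card (Quotient s) := by
  classical
  -- Every class of the glued relation contains exactly one class of `s` other than that of `b`.
  let f : {z : Quotient s // z ≠ Quotient.mk s b} → Quotient (s.glue a b) :=
    fun z => Quotient.map' id (fun _ _ k => le_glue s a b k) z.1
  have hf : Function.Bijective f := by
    constructor
    · rintro ⟨z, hz⟩ ⟨w, hw⟩ e
      induction z using Quotient.inductionOn with | _ x
      induction w using Quotient.inductionOn with | _ y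
      have e' : s.glue a b x y := Quotient.exact e
      rcases e' with k | ⟨_, k⟩ | ⟨k, _⟩
      · exact Subtype.ext (Quotient.sound k)
      · exact absurd (Quotient.sound (s.symm k)) hw
      · exact absurd (Quotient.sound k) hz
    · intro w
      induction w using Quotient.inductionOn with | _ y
      by_cases hy : s y b
      · exact ⟨⟨Quotient.mk s a, fun e => h (Quotient.exact e)⟩,
          Quotient.sound (Or.inr (Or.inl ⟨s.refl a, s.symm hy⟩))⟩
      · exact ⟨⟨Quotient.mk s y, fun e => hy (Quotient.exact e)⟩, rfl⟩
  rw [← Nat.card_eq_of_bijective f hf]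
  have := Fintype.ofFinite (Quotient s)
  rw [Nat.card_eq_fintype_card, Nat.card_eq_fintype_card, Fintype.card_subtype_compl,
    Fintype.card_subtype_eq]
  have : 0 < Fintype.card (Quotient s) := Fintype.card_pos_iff.2 ⟨Quotient.mk s b⟩
  omega

end Setoid

/-! ### Permutations that differ by a transposition -/

namespace Equiv.Perm

variable {β : Type} [Finite β] [DecidableEq β]

theorem sameCycle_of_swap_of_not_sameCycle {p q : Perm β} {E : Set β} {a b : β}
    (hp : Set.MapsTo p E E) (ha : a ∈ E) (hq : ∀ x ∈ E, q x = swap a b (p x))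
    (h : ¬ p.SameCycle a b) : q.SameCycle a b := by
  have hE : ∀ i : ℕ, (p ^ i) a ∈ E := fun i => by
    induction i with
    | zero => simpa
    | succ i ih => rw [pow_succ', mul_apply]; exact hp ih
  have hex : ∃ j : ℕ, 0 < j ∧ (p ^ j) a = a :=
    ⟨orderOf p, orderOf_pos p, by rw [pow_orderOf_eq_one]; rfl⟩
  classical
  let j := Nat.find hex
  obtain ⟨hj, hja⟩ := Nat.find_spec hex
  -- Until it returns to `a`, the orbit of `a` is the same for `p` and `q`.
  have key : ∀ i, i < j → (q ^ i) a = (p ^ i) a := fun i => by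
    induction i with
    | zero => simp
    | succ i ih =>
      intro hi
      rw [pow_succ', mul_apply, ih (by omega), hq _ (hE i), ← mul_apply p, ← pow_succ',
        swap_apply_of_ne_of_ne]
      · exact fun e => Nat.find_min hex hi ⟨by omega, e⟩
      · exact fun e => h ⟨(i + 1 : ℕ), by rw [zpow_natCast]; exact e⟩
  refine ⟨(j : ℕ), ?_⟩
  obtain ⟨i, hi⟩ : ∃ i, j = i + 1 := ⟨j - 1, by omega⟩
  rw [zpow_natCast, hi, pow_succ', mul_apply, key i (by omega), hq _ (hE i), ← mul_apply p,
    ← pow_succ', ← hi, show (p ^ j) a = a from hja, swap_apply_left]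

theorem not_sameCycle_of_swap_of_sameCycle {p q : Perm β} {E : Set β} {a b : β} (hab : a ≠ b)
    (hp : Set.MapsTo p E E) (ha : a ∈ E) (hq : ∀ x ∈ E, q x = swap a b (p x))
    (h : p.SameCycle a b) : ¬ q.SameCycle a b := by
  have hE : ∀ i : ℕ, (p ^ i) a ∈ E := fun i => by
    induction i with
    | zero => simpa
    | succ i ih => rw [pow_succ', mul_apply]; exact hp ih
  have hex : ∃ j : ℕ, 0 < j ∧ ((p ^ j) a = b ∨ (p ^ j) a = a) :=
    ⟨orderOf p, orderOf_pos p, Or.inr (by rw [pow_orderOf_eq_one]; rfl)⟩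
  classical
  let j := Nat.find hex
  obtain ⟨hj, hja⟩ := Nat.find_spec hex
  have hne : ∀ i, 0 < i → i < j → (p ^ i) a ≠ b ∧ (p ^ i) a ≠ a := fun i h0 hi =>
    ⟨fun e => Nat.find_min hex hi ⟨h0, Or.inl e⟩, fun e => Nat.find_min hex hi ⟨h0, Or.inr e⟩⟩
  have hjb : (p ^ j) a = b := by
    rcases hja with e | e
    · exact e
    · exfalso
      obtain ⟨i, _, hi⟩ := h.exists_pow_eq'
      have hm : (p ^ (i % j)) a = b := by
        rw [← hi]
        conv_rhs => rw [← Nat.mod_add_div i j, pow_add, pow_mul, mul_apply]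
        congr 1
        have : ∀ l : ℕ, ((p ^ j) ^ l) a = a := fun l => by
          induction l with
          | zero => simp
          | succ l ih => rw [pow_succ, mul_apply, show (p ^ j) a = a from e, ih]
        exact (this _).symm
      rcases Nat.eq_zero_or_pos (i % j) with h0 | h0
      · rw [h0] at hm; exact hab (by simpa using hm)
      · exact (hne _ h0 (Nat.mod_lt _ hj)).1 hm
  have key : ∀ i, i < j → (q ^ i) a = (p ^ i) a := fun i => by
    induction i with
    | zero => simp
    | succ i ih =>
      intro hi
      obtain ⟨h1, h2⟩ := hne (i + 1) (by omega) hi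
      rw [pow_succ', mul_apply, ih (by omega), hq _ (hE i), ← mul_apply p, ← pow_succ',
        swap_apply_of_ne_of_ne h2 h1]
  have hqj : (q ^ j) a = a := by
    obtain ⟨i, hi⟩ : ∃ i, j = i + 1 := ⟨j - 1, by omega⟩
    rw [hi, pow_succ', mul_apply, key i (by omega), hq _ (hE i), ← mul_apply p,
      ← pow_succ', ← hi, hjb, swap_apply_right]
  -- So the orbit of `a` under `q` consists of the `p ^ i a` with `i < j`, and misses `b`.
  intro hs
  obtain ⟨i, _, hi⟩ := hs.exists_pow_eq'
  have hm : (q ^ (i % j)) a = b := by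
    rw [← hi]
    conv_rhs => rw [← Nat.mod_add_div i j, pow_add, pow_mul, mul_apply]
    congr 1
    have : ∀ l : ℕ, ((q ^ j) ^ l) a = a := fun l => by
      induction l with
      | zero => simp
      | succ l ih => rw [pow_succ, mul_apply, hqj, ih]
    exact (this _).symm
  rw [key _ (Nat.mod_lt _ hj)] at hm
  rcases Nat.eq_zero_or_pos (i % j) with h0 | h0
  · rw [h0] at hm; exact hab (by simpa using hm)
  · exact (hne _ h0 (Nat.mod_lt _ hj)).1 hm

/-- Composing with a transposition changes whether the two transposed points lie on one cycle. It
is enough that the two permutations differ by the transposition on an invariant set. -/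
theorem sameCycle_iff_not_of_swap {p q : Perm β} {E : Set β} {a b : β} (hab : a ≠ b)
    (hp : Set.MapsTo p E E) (ha : a ∈ E) (hq : ∀ x ∈ E, q x = swap a b (p x)) :
    p.SameCycle a b ↔ ¬ q.SameCycle a b :=
  ⟨not_sameCycle_of_swap_of_sameCycle hab hp ha hq, fun h => by_contra fun h' =>
    h (sameCycle_of_swap_of_not_sameCycle hp ha hq h')⟩

end Equiv.Perm

/-! ### The cycles of a state and of the state changed at one crossing -/

namespace LinkDiagram

variable (D : LinkDiagram)

/-- The half-edges of a diagram, and one further point for each component without crossings. -/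
abbrev Pt : Type := D.HalfEdge ⊕ Fin D.loops

/-- The cycle of a state through a point. -/
def cl (α : D.State) : D.Pt → D.Cycle α := Sum.map (Quot.mk _) id

/-- Two points are on the same cycle of the state `α`. -/
def rel (α : D.State) : Setoid D.Pt := Setoid.ker (D.cl α)

/-- The first of two opposite half-edges at a crossing. Every cycle through the crossing passes
through `ptA m` or `ptB m`, for both smoothings. -/
def ptA (m : Fin D.n) : D.Pt := Sum.inl (m, 0)

/-- The half-edge opposite to `ptA m`. -/
def ptB (m : Fin D.n) : D.Pt := Sum.inl (m, 2)

/-- The state with the other smoothing at `m`. -/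
def toggle (m : Fin D.n) (α : D.State) : D.State := Function.update α m (!α m)

variable {D}

theorem cl_surjective (α : D.State) : Function.Surjective (D.cl α) := by
  rintro (z | l)
  · obtain ⟨h, rfl⟩ := Quot.exists_rep z
    exact ⟨Sum.inl h, rfl⟩
  · exact ⟨Sum.inr l, rfl⟩

theorem rel_iff {α : D.State} {p q : D.Pt} : D.rel α p q ↔ D.cl α p = D.cl α q := Iff.rfl

@[simp] theorem toggle_toggle (m : Fin D.n) (α : D.State) : D.toggle m (D.toggle m α) = α := by
  simp [toggle]

@[simp] theorem toggle_self (m : Fin D.n) (α : D.State) : D.toggle m α m = !α m := by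
  simp [toggle]

theorem toggle_of_ne {m c : Fin D.n} (h : c ≠ m) (α : D.State) : D.toggle m α c = α c := by
  simp [toggle, h]

theorem toggle_comm {m m' : Fin D.n} (h : m ≠ m') (α : D.State) :
    D.toggle m (D.toggle m' α) = D.toggle m' (D.toggle m α) := by
  funext c
  by_cases h1 : c = m <;> by_cases h2 : c = m' <;>
    simp_all [toggle, Function.update_apply]

theorem rel_mate (α : D.State) (h : D.HalfEdge) :
    D.rel α (Sum.inl h) (Sum.inl (D.mate h)) :=
  congrArg Sum.inl (Quot.sound (Or.inl rfl))

theorem rel_smoothArc (α : D.State) (h : D.HalfEdge) :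
    D.rel α (Sum.inl h) (Sum.inl (D.smoothArc α h)) :=
  congrArg Sum.inl (Quot.sound (Or.inr rfl))

/-- The relation `rel α` is generated by the edges and the arcs of the smoothed crossings. -/
theorem rel_le {α : D.State} {s : Setoid D.Pt}
    (h1 : ∀ h : D.HalfEdge, s (Sum.inl h) (Sum.inl (D.mate h)))
    (h2 : ∀ h : D.HalfEdge, s (Sum.inl h) (Sum.inl (D.smoothArc α h))) : D.rel α ≤ s := by
  have key : ∀ h h', Relation.EqvGen (D.stateStep α) h h' → s (Sum.inl h) (Sum.inl h') := by
    intro h h' e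
    induction e with
    | rel x y hxy =>
      rcases hxy with rfl | rfl
      · exact h1 x
      · exact h2 x
    | refl x => exact s.refl _
    | symm x y _ ih => exact s.symm ih
    | trans x y z _ _ ih ih' => exact s.trans ih ih'
  rintro (h | l) (h' | l') e
  · exact key h h' (Quot.eqvGen_exact (Sum.inl_injective e))
  · exact absurd (show Sum.inl _ = Sum.inr _ from e) (by simp)
  · exact absurd (show Sum.inr _ = Sum.inl _ from e) (by simp)
  · have : l = l' := Sum.inr_injective e
    rw [this]

theorem fin4_cases (k : Fin 4) : k = 0 ∨ k = 1 ∨ k = 2 ∨ k = 3 := by omega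

/-- Once the two half-edges `0` and `2` are related, all half-edges of a crossing are. -/
theorem rel_at_crossing {α : D.State} {s : Setoid D.Pt} (hs : D.rel α ≤ s) {m : Fin D.n}
    (hm : s (D.ptA m) (D.ptB m)) (k : Fin 4) : s (D.ptA m) (Sum.inl (m, k)) := by
  have h0 := hs (rel_smoothArc α (m, 0))
  have h2 := hs (rel_smoothArc α (m, 2))
  rcases fin4_cases k with rfl | rfl | rfl | rfl <;> cases hα : α m <;>
    simp only [smoothArc, hα] at h0 h2
  · exact s.refl _
  · exact s.refl _
  · exact h0
  · exact s.trans hm h2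
  · exact hm
  · exact hm
  · exact s.trans hm h2
  · exact h0

theorem rel_le_glue_toggle (α : D.State) (m : Fin D.n) :
    D.rel α ≤ (D.rel (D.toggle m α)).glue (D.ptA m) (D.ptB m) := by
  refine rel_le (fun h => Setoid.le_glue _ _ _ (rel_mate _ h)) fun h => ?_
  obtain ⟨c, k⟩ := h
  by_cases hc : c = m
  · subst hc
    have key := rel_at_crossing (Setoid.le_glue (D.rel (D.toggle c α)) (D.ptA c) (D.ptB c))
      (Setoid.glue_pair _ _ _)
    have h1 : D.smoothArc α (c, k) = (c, (D.smoothArc α (c, k)).2) := by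
      unfold smoothArc
      rcases fin4_cases k with rfl | rfl | rfl | rfl <;> cases α c <;> rfl
    rw [h1]
    exact Setoid.trans' _ (Setoid.symm' _ (key k)) (key _)
  · have h1 : D.smoothArc α (c, k) = D.smoothArc (D.toggle m α) (c, k) := by
      simp only [smoothArc, toggle_of_ne hc]
    rw [h1]
    exact Setoid.le_glue _ _ _ (rel_smoothArc _ _)

theorem glue_toggle (α : D.State) (m : Fin D.n) :
    (D.rel (D.toggle m α)).glue (D.ptA m) (D.ptB m) =
      (D.rel α).glue (D.ptA m) (D.ptB m) := by
  apply le_antisymm <;> refine Setoid.glue_le ?_ (Setoid.glue_pair _ _ _)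
  · simpa using rel_le_glue_toggle (D.toggle m α) m
  · exact rel_le_glue_toggle α m

/-! ### In an alternating diagram a change of smoothing merges or splits cycles -/

theorem isUpper_smoothArc (α : D.State) (h : D.HalfEdge) :
    D.isUpper (D.smoothArc α h) = !D.isUpper h := by
  obtain ⟨c, k⟩ := h
  rcases fin4_cases k with rfl | rfl | rfl | rfl <;> cases hα : α c <;>
    simp [smoothArc, hα, isUpper]

theorem smoothArc_smoothArc (α : D.State) (h : D.HalfEdge) :
    D.smoothArc α (D.smoothArc α h) = h := by
  obtain ⟨c, k⟩ := h
  rcases fin4_cases k with rfl | rfl | rfl | rfl <;> cases hα : α c <;> simp [smoothArc, hα]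

theorem isUpper_mate (halt : D.Alternating) (h : D.HalfEdge) :
    D.isUpper (D.mate h) = !D.isUpper h := by
  have := halt h
  revert this
  cases D.isUpper (D.mate h) <;> cases D.isUpper h <;> simp

/-- The permutation that follows an edge and then the arc of the smoothed crossing at its end. In
an alternating diagram it preserves the half-edges of the lower strands, so that it travels around
every cycle of the state in one direction. -/
def travel (α : D.State) : Equiv.Perm D.HalfEdge where
  toFun h := D.smoothArc α (D.mate h)
  invFun h := D.mate (D.smoothArc α h)
  left_inv h := by simp only [smoothArc_smoothArc, D.mate_mate]
  right_inv h := by simp only [D.mate_mate, smoothArc_smoothArc]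

theorem travel_apply (α : D.State) (h : D.HalfEdge) :
    travel α h = D.smoothArc α (D.mate h) := rfl

/-- The cycles of a state correspond to the cycles of `travel`. -/
theorem rel_iff_sameCycle (halt : D.Alternating) (α : D.State) {h h' : D.HalfEdge}
    (hh : D.isUpper h = false) (hh' : D.isUpper h' = false) :
    D.rel α (Sum.inl h) (Sum.inl h') ↔ (travel α).SameCycle h h' := by
  constructor
  · -- A half-edge of an upper strand is represented by the other end of its arc.
    let rep : D.Pt → D.HalfEdge ⊕ Fin D.loops := Sum.map
      (fun h => if D.isUpper h then D.smoothArc α h else h) id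
    let s : Setoid (D.HalfEdge ⊕ Fin D.loops) :=
      ⟨Sum.LiftRel (travel α).SameCycle (· = ·), fun x => by
        cases x
        · exact Sum.LiftRel.inl (Equiv.Perm.SameCycle.refl _ _)
        · exact Sum.LiftRel.inr rfl, fun e => by
        cases e with
        | inl e => exact Sum.LiftRel.inl e.symm
        | inr e => exact Sum.LiftRel.inr e.symm, fun e e' => by
        cases e with
        | inl e => cases e' with | inl e' => exact Sum.LiftRel.inl (e.trans e')
        | inr e => cases e' with | inr e' => exact Sum.LiftRel.inr (e.trans e')⟩
    have hs : D.rel α ≤ s.comap rep := by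
      have step : ∀ h, (travel α).SameCycle h (D.smoothArc α (D.mate h)) :=
        fun h => ⟨1, by simp [travel_apply]⟩
      refine rel_le (fun h => ?_) (fun h => ?_)
      · refine Sum.LiftRel.inl ?_
        simp only [isUpper_mate halt]
        cases hu : D.isUpper h
        · exact step h
        · simpa [D.mate_mate] using (step (D.mate h)).symm
      · refine Sum.LiftRel.inl ?_
        simp only [isUpper_smoothArc]
        cases hu : D.isUpper h <;> simp [smoothArc_smoothArc, Equiv.Perm.SameCycle.refl]
    intro e
    have := hs e
    cases this with
    | inl e => simpa [hh, hh'] using e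
  · rintro ⟨i, rfl⟩
    have step : ∀ h, D.rel α (Sum.inl h) (Sum.inl (travel α h)) := fun h =>
      Setoid.trans' _ (rel_mate α h) (rel_smoothArc α _)
    clear hh'
    induction i with
    | zero => exact Setoid.refl' _ _
    | succ i ih =>
      rw [add_comm, zpow_add, zpow_one]
      exact Setoid.trans' _ ih (step _)
    | pred i ih =>
      refine Setoid.trans' _ ih (Setoid.symm' _ ?_)
      have := step ((travel α ^ (-(i : ℤ) - 1)) h)
      rwa [← Equiv.Perm.mul_apply, ← zpow_one_add, add_sub_cancel] at this

/-- No cycle is turned into one cycle: two cycles merge or one cycle splits. -/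
theorem rel_toggle (halt : D.Alternating) (α : D.State) (m : Fin D.n) :
    D.rel α (D.ptA m) (D.ptB m) ↔ ¬ D.rel (D.toggle m α) (D.ptA m) (D.ptB m) := by
  have h0 : D.isUpper (m, 0) = false := by simp [isUpper]
  have h2 : D.isUpper (m, 2) = false := by simp [isUpper]
  rw [ptA, ptB, rel_iff_sameCycle halt _ h0 h2, rel_iff_sameCycle halt _ h0 h2]
  refine Equiv.Perm.sameCycle_iff_not_of_swap (E := {h | D.isUpper h = false}) (by simp)
    (fun h hh => ?_) h0 fun h hh => ?_
  · simp only [Set.mem_ofPred_eq] at hh ⊢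
    rw [travel_apply, isUpper_smoothArc, isUpper_mate halt, hh]
    rfl
  · have hm : D.isUpper (D.mate h) = true := by
      rw [isUpper_mate halt, show D.isUpper h = false from hh]; rfl
    simp only [travel_apply]
    generalize D.mate h = g at hm
    obtain ⟨c, k⟩ := g
    by_cases hc : c = m
    · subst hc
      rcases fin4_cases k with rfl | rfl | rfl | rfl <;> cases hα : α c <;>
        simp_all [smoothArc, isUpper]
    · have : (D.smoothArc α (c, k)).1 = c := by
        unfold smoothArc
        rcases fin4_cases k with rfl | rfl | rfl | rfl <;> cases α c <;> rfl
      rw [Equiv.swap_apply_of_ne_of_ne]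
      · simp only [smoothArc, toggle_of_ne hc]
      · exact fun e => hc (by rw [← this, e])
      · exact fun e => hc (by rw [← this, e])

theorem rel_toggle_of_not (halt : D.Alternating) {α : D.State} {m : Fin D.n}
    (h : ¬ D.rel α (D.ptA m) (D.ptB m)) : D.rel (D.toggle m α) (D.ptA m) (D.ptB m) := by
  by_contra h'
  exact h ((rel_toggle halt α m).2 h')

/-- The relation of a state after two cycles have merged. -/
theorem rel_toggle_eq_glue (halt : D.Alternating) {α : D.State} {m : Fin D.n}
    (h : ¬ D.rel α (D.ptA m) (D.ptB m)) :
    D.rel (D.toggle m α) = (D.rel α).glue (D.ptA m) (D.ptB m) := by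
  rw [← glue_toggle, Setoid.glue_eq_self (rel_toggle_of_not halt h)]

/-- The number of cycles of a state. -/
noncomputable def cycleCount (α : D.State) : ℕ := Fintype.card (D.Cycle α)

theorem cycleCount_eq (α : D.State) : cycleCount α = Nat.card (Quotient (D.rel α)) := by
  rw [cycleCount, ← Nat.card_eq_fintype_card]
  exact (Nat.card_congr (Setoid.quotientKerEquivOfSurjective _ (cl_surjective α))).symm

theorem cycleCount_toggle_of_not (halt : D.Alternating) {α : D.State} {m : Fin D.n}
    (h : ¬ D.rel α (D.ptA m) (D.ptB m)) : cycleCount (D.toggle m α) + 1 = cycleCount α := by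
  rw [cycleCount_eq, cycleCount_eq, rel_toggle_eq_glue halt h, Setoid.card_glue h]

theorem cycleCount_toggle_of_rel (halt : D.Alternating) {α : D.State} {m : Fin D.n}
    (h : D.rel α (D.ptA m) (D.ptB m)) : cycleCount (D.toggle m α) = cycleCount α + 1 := by
  have := cycleCount_toggle_of_not halt ((rel_toggle halt α m).1 h)
  rw [toggle_toggle] at this
  exact this.symm

/-! ### Partial resolutions -/

/-- The relation whose classes are the connected components of the diagram in which the crossings
outside `U` are smoothed as in `α`. -/
def compRel (U : Finset (Fin D.n)) (α : D.State) : Setoid D.Pt :=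
  sInf {s | D.rel α ≤ s ∧ ∀ m ∈ U, s (D.ptA m) (D.ptB m)}

theorem rel_le_compRel (U : Finset (Fin D.n)) (α : D.State) : D.rel α ≤ compRel U α :=
  le_sInf fun _ hs => hs.1

theorem compRel_pair {U : Finset (Fin D.n)} (α : D.State) {m : Fin D.n} (hm : m ∈ U) :
    compRel U α (D.ptA m) (D.ptB m) := fun _ hs => hs.2 m hm

theorem compRel_le {U : Finset (Fin D.n)} {α : D.State} {s : Setoid D.Pt} (h : D.rel α ≤ s)
    (hU : ∀ m ∈ U, s (D.ptA m) (D.ptB m)) : compRel U α ≤ s := sInf_le ⟨h, hU⟩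

theorem compRel_empty (α : D.State) : compRel ∅ α = D.rel α :=
  le_antisymm (compRel_le le_rfl (by simp)) (rel_le_compRel _ _)

theorem compRel_glue {U : Finset (Fin D.n)} (α : D.State) {c : Fin D.n} (hc : c ∈ U) :
    (compRel (U.erase c) α).glue (D.ptA c) (D.ptB c) = compRel U α := by
  apply le_antisymm
  · exact Setoid.glue_le (compRel_le (rel_le_compRel _ _)
      fun m hm => compRel_pair α (Finset.mem_of_mem_erase hm)) (compRel_pair α hc)
  · refine compRel_le ((rel_le_compRel _ _).trans (Setoid.le_glue _ _ _)) fun m hm => ?_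
    by_cases h : m = c
    · subst h; exact Setoid.glue_pair _ _ _
    · exact Setoid.le_glue _ _ _ (compRel_pair α (Finset.mem_erase.2 ⟨h, hm⟩))

theorem rel_toggle_le_compRel {U : Finset (Fin D.n)} (α : D.State) {m : Fin D.n} (hm : m ∈ U) :
    D.rel (D.toggle m α) ≤ compRel U α := by
  refine (Setoid.le_glue _ (D.ptA m) (D.ptB m)).trans ?_
  rw [glue_toggle]
  exact Setoid.glue_le (rel_le_compRel _ _) (compRel_pair α hm)

theorem compRel_toggle {U : Finset (Fin D.n)} (α : D.State) {m : Fin D.n} (hm : m ∈ U) :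
    compRel U (D.toggle m α) = compRel U α := by
  apply le_antisymm
  · exact compRel_le (rel_toggle_le_compRel α hm) fun _ h => compRel_pair α h
  · refine compRel_le ?_ fun _ h => compRel_pair _ h
    simpa using rel_toggle_le_compRel (D.toggle m α) hm

/-- The state that is `α` outside `U` and constant on `U`. -/
def fill (U : Finset (Fin D.n)) (b : Bool) (α : D.State) : D.State :=
  fun m => if m ∈ U then b else α m

theorem update_eq_or_toggle (α : D.State) (c : Fin D.n) (b : Bool) :
    Function.update α c b = α ∨ Function.update α c b = D.toggle c α := by
  by_cases h : b = α c
  · left; rw [h, Function.update_eq_self]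
  · right
    have : b = !α c := by revert h; cases b <;> cases α c <;> simp
    rw [this, toggle]

theorem compRel_update {U : Finset (Fin D.n)} (α : D.State) {c : Fin D.n} (hc : c ∈ U) (b : Bool) :
    compRel U (Function.update α c b) = compRel U α := by
  rcases update_eq_or_toggle α c b with h | h <;> rw [h]
  exact compRel_toggle α hc

theorem compRel_congr {U : Finset (Fin D.n)} {α β : D.State} (h : ∀ c ∉ U, β c = α c) :
    compRel U β = compRel U α := by
  classical
  -- Change the smoothings in `U` one after the other.
  have key : ∀ V ⊆ U, compRel U (fun c => if c ∈ V then β c else α c) = compRel U α := by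
    intro V
    induction V using Finset.induction_on with
    | empty => simp
    | insert c V _ ih =>
      intro hV
      rw [← ih ((Finset.subset_insert _ _).trans hV), ← compRel_update
        (fun c => if c ∈ V then β c else α c) (hV (Finset.mem_insert_self c V)) (β c)]
      congr 1
      funext x
      by_cases hx : x = c <;> simp [hx]
  rw [← key U subset_rfl]
  congr 1
  funext c
  by_cases hc : c ∈ U <;> simp [hc, h]

theorem fill_erase_update {U : Finset (Fin D.n)} {c : Fin D.n} (hc : c ∈ U) (b : Bool)
    (α : D.State) : fill (U.erase c) b (Function.update α c b) = fill U b α := by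
  funext x
  by_cases hx : x = c
  · subst hx; simp [fill, hc]
  · simp [fill, hx]

theorem fill_erase_update_not {U : Finset (Fin D.n)} {c : Fin D.n} (hc : c ∈ U) (b : Bool)
    (α : D.State) :
    fill (U.erase c) b (Function.update α c (!b)) = D.toggle c (fill U b α) := by
  funext x
  by_cases hx : x = c
  · subst hx; simp [fill, hc]
  · simp [fill, hx, toggle_of_ne hx]

theorem compRel_erase_rel {U : Finset (Fin D.n)} {α β : D.State} (h : ∀ c ∉ U, β c = α c) :
    D.rel β ≤ compRel U α := by
  rw [← compRel_congr h]; exact rel_le_compRel _ _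

/-- The Euler characteristic estimate for partial resolutions: the genera of the surfaces on which
the components are drawn are not negative. -/
theorem cycleCount_add_le (halt : D.Alternating) (U : Finset (Fin D.n)) (α : D.State) :
    cycleCount (fill U false α) + cycleCount (fill U true α) ≤
      U.card + 2 * Nat.card (Quotient (compRel U α)) := by
  induction hn : U.card generalizing U α with
  | zero =>
    obtain rfl := Finset.card_eq_zero.1 hn
    have : ∀ b, fill ∅ b α = α := fun b => by funext c; simp [fill]
    rw [this, this, compRel_empty, cycleCount_eq]
    omega
  | succ k ih =>
    obtain ⟨c, hc⟩ : U.Nonempty := Finset.card_pos.1 (by omega)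
    have ih' := ih (U.erase c) (Function.update α c false)
      (by rw [Finset.card_erase_of_mem hc, hn]; rfl)
    rw [fill_erase_update hc] at ih'
    have e1 := fill_erase_update_not hc true α
    rw [Bool.not_true] at e1
    rw [e1] at ih'
    rw [← compRel_update α hc false, ← compRel_glue _ hc]
    set β := Function.update α c false
    by_cases h : compRel (U.erase c) β (D.ptA c) (D.ptB c)
    · rw [Setoid.glue_eq_self h]
      by_cases h' : D.rel (fill U true α) (D.ptA c) (D.ptB c)
      · have := cycleCount_toggle_of_rel halt h'
        omega
      · have := cycleCount_toggle_of_not halt h'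
        omega
    · have h1 := Setoid.card_glue h
      have h' : D.rel (fill U true α) (D.ptA c) (D.ptB c) := by
        rw [rel_toggle halt, ← e1]
        intro h'
        refine h (compRel_erase_rel (fun x hx => ?_) h')
        simp [fill, hx]
      have := cycleCount_toggle_of_rel halt h'
      omega

/-! ### Labels and local degrees -/

/-- The label of the cycle through a point. -/
def lab (S : D.EnhancedState) (p : D.Pt) : Bool := S.2 (D.cl S.1 p)

theorem lab_congr {S : D.EnhancedState} {p q : D.Pt} (h : D.rel S.1 p q) : lab S p = lab S q :=
  congrArg S.2 h

theorem ext_lab {S T : D.EnhancedState} (h : S.1 = T.1) (hl : ∀ p, lab S p = lab T p) : S = T := by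
  obtain ⟨α, s⟩ := S
  obtain ⟨β, t⟩ := T
  obtain rfl : α = β := h
  congr 1
  funext z
  obtain ⟨p, rfl⟩ := cl_surjective α z
  exact hl p

/-- The point is not on a cycle through the crossing. -/
def Away (m : Fin D.n) (α : D.State) (p : D.Pt) : Prop :=
  ¬ (D.rel α).glue (D.ptA m) (D.ptB m) p (D.ptA m)

theorem away_iff {m : Fin D.n} {α : D.State} {p : D.Pt} :
    Away m α p ↔ ¬ D.rel α p (D.ptA m) ∧ ¬ D.rel α p (D.ptB m) := by
  rw [Away, Setoid.glue_apply]
  have := Setoid.refl' (D.rel α) (D.ptA m)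
  tauto

theorem away_toggle {m : Fin D.n} {α : D.State} {p : D.Pt} :
    Away m (D.toggle m α) p ↔ Away m α p := by
  rw [Away, Away, glue_toggle]

theorem glue_iff_of_away {m : Fin D.n} {α : D.State} {p q : D.Pt} (h : Away m α p) :
    (D.rel α).glue (D.ptA m) (D.ptB m) p q ↔ D.rel α p q := by
  rw [away_iff] at h
  rw [Setoid.glue_apply]
  tauto

theorem rel_toggle_of_away {m : Fin D.n} {α : D.State} {p q : D.Pt} (h : Away m α p) :
    D.rel (D.toggle m α) p q ↔ D.rel α p q := by
  rw [← glue_iff_of_away h, ← glue_toggle, glue_iff_of_away (away_toggle.2 h)]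

theorem agreeAway_iff {m : Fin D.n} {S T : D.EnhancedState} :
    AgreeAway m S T ↔ ∀ p, Away m S.1 p → lab S p = lab T p := by
  constructor
  · rintro ⟨h1, h2⟩ (h | l) hp
    · rw [away_iff] at hp
      exact h1 h hp.1 hp.2
    · exact h2 l
  · refine fun H => ⟨fun h ha hb => H (Sum.inl h) (away_iff.2 ⟨ha, hb⟩), fun l => H (Sum.inr l) ?_⟩
    rw [away_iff]
    constructor <;> intro e <;> exact absurd (show Sum.inr _ = Sum.inl _ from e) (by simp)

/-- The degree of a label. -/
def labDeg (b : Bool) : ℤ := if b then 1 else -1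

open scoped Classical in
/-- The sum of the degrees of the labels of those cycles that meet a set of points. -/
noncomputable def degOn (W : Set D.Pt) (S : D.EnhancedState) : ℤ :=
  ∑ z, if ∃ p ∈ W, D.cl S.1 p = z then labDeg (S.2 z) else 0

/-- The degree of an enhanced state: the sum of the degrees of its labels. -/
noncomputable def deg (S : D.EnhancedState) : ℤ := ∑ z, labDeg (S.2 z)

theorem degOn_univ (S : D.EnhancedState) : degOn Set.univ S = deg S := by
  refine Finset.sum_congr rfl fun z _ => if_pos ?_
  obtain ⟨p, hp⟩ := cl_surjective S.1 z
  exact ⟨p, trivial, hp⟩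

/-- The relation `s` does not leave the set `W`. -/
def Saturated (W : Set D.Pt) (s : Setoid D.Pt) : Prop := ∀ p q, s p q → (p ∈ W ↔ q ∈ W)

theorem Saturated.mono {W : Set D.Pt} {s t : Setoid D.Pt} (h : Saturated W t) (hst : s ≤ t) :
    Saturated W s := fun p q k => h p q (hst k)

open scoped Classical in
/-- The part of the degree that comes from the cycles through a crossing. -/
noncomputable def locDeg (m : Fin D.n) (S : D.EnhancedState) : ℤ :=
  labDeg (lab S (D.ptA m)) + if D.rel S.1 (D.ptA m) (D.ptB m) then 0 else labDeg (lab S (D.ptB m))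

open scoped Classical in
theorem sum_cycle_eq (m : Fin D.n) (α : D.State) (f : D.Cycle α → ℤ) :
    ∑ z, f z = ∑ z with z ≠ D.cl α (D.ptA m) ∧ z ≠ D.cl α (D.ptB m), f z +
      (f (D.cl α (D.ptA m)) +
        if D.rel α (D.ptA m) (D.ptB m) then 0 else f (D.cl α (D.ptB m))) := by
  rw [← Finset.sum_filter_add_sum_filter_not Finset.univ
    (fun z => z ≠ D.cl α (D.ptA m) ∧ z ≠ D.cl α (D.ptB m))]
  congr 1
  have h : (Finset.univ.filter fun z => ¬(z ≠ D.cl α (D.ptA m) ∧ z ≠ D.cl α (D.ptB m))) =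
      {D.cl α (D.ptA m), D.cl α (D.ptB m)} := by
    ext z
    simp only [Finset.mem_filter, Finset.mem_univ, true_and, Finset.mem_insert,
      Finset.mem_singleton]
    tauto
  rw [h]
  split_ifs with e
  · rw [← rel_iff.1 e]; simp
  · exact Finset.sum_pair e

open scoped Classical in
theorem sum_away_eq {m : Fin D.n} {α β : D.State} (hβ : β = D.toggle m α)
    (f : D.Cycle α → ℤ) (g : D.Cycle β → ℤ)
    (hfg : ∀ p, Away m α p → f (D.cl α p) = g (D.cl β p)) :
    ∑ z with z ≠ D.cl α (D.ptA m) ∧ z ≠ D.cl α (D.ptB m), f z =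
      ∑ z with z ≠ D.cl β (D.ptA m) ∧ z ≠ D.cl β (D.ptB m), g z := by
  subst hβ
  -- A cycle that does not pass through the crossing is a cycle of both states.
  choose r hr using cl_surjective (D := D) α
  choose r' hr' using cl_surjective (D := D) (D.toggle m α)
  have aw : ∀ z, z ≠ D.cl α (D.ptA m) ∧ z ≠ D.cl α (D.ptB m) → Away m α (r z) := fun z hz => by
    rw [away_iff, rel_iff, rel_iff, hr]; exact hz
  have aw' : ∀ z, z ≠ D.cl (D.toggle m α) (D.ptA m) ∧ z ≠ D.cl (D.toggle m α) (D.ptB m) →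
      Away m α (r' z) := fun z hz => by
    rw [← away_toggle, away_iff, rel_iff, rel_iff, hr']; exact hz
  refine Finset.sum_bij' (fun z _ => D.cl (D.toggle m α) (r z)) (fun z _ => D.cl α (r' z))
    ?_ ?_ ?_ ?_ ?_
  · intro z hz
    have h := aw z (Finset.mem_filter.1 hz).2
    rw [← away_toggle, away_iff] at h
    exact Finset.mem_filter.2 ⟨Finset.mem_univ _, h⟩
  · intro z hz
    have h := aw' z (Finset.mem_filter.1 hz).2
    rw [away_iff] at h
    exact Finset.mem_filter.2 ⟨Finset.mem_univ _, h⟩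
  · intro z hz
    have h := aw z (Finset.mem_filter.1 hz).2
    have : D.rel (D.toggle m α) (r z) (r' (D.cl (D.toggle m α) (r z))) := (hr' _).symm
    rw [rel_toggle_of_away h] at this
    exact (rel_iff.1 this).symm.trans (hr z)
  · intro z hz
    have h := aw' z (Finset.mem_filter.1 hz).2
    have : D.rel α (r' z) (r (D.cl α (r' z))) := (hr _).symm
    rw [← rel_toggle_of_away h] at this
    exact (rel_iff.1 this).symm.trans (hr' z)
  · intro z hz
    have h := aw z (Finset.mem_filter.1 hz).2
    rw [← hfg _ h, hr]

theorem ite_degOn {W : Set D.Pt} {α : D.State} (hW : Saturated W (D.rel α)) (p : D.Pt) :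
    (∃ q ∈ W, D.cl α q = D.cl α p) ↔ p ∈ W :=
  ⟨fun ⟨q, hq, e⟩ => (hW q p e).1 hq, fun h => ⟨p, h, rfl⟩⟩

open scoped Classical in
theorem degOn_sub_degOn {m : Fin D.n} {S T : D.EnhancedState} (hT : T.1 = D.toggle m S.1)
    (hST : AgreeAway m S T) {W : Set D.Pt} (hS : Saturated W (D.rel S.1))
    (hT' : Saturated W (D.rel T.1)) (hab : D.ptA m ∈ W ↔ D.ptB m ∈ W) :
    degOn W T - degOn W S = if D.ptA m ∈ W then locDeg m T - locDeg m S else 0 := by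
  rw [agreeAway_iff] at hST
  have key := sum_away_eq hT (fun z => if ∃ p ∈ W, D.cl S.1 p = z then labDeg (S.2 z) else 0)
    (fun z => if ∃ p ∈ W, D.cl T.1 p = z then labDeg (T.2 z) else 0) (fun p hp => by
      simp only [ite_degOn hS, ite_degOn hT']
      have := hST p hp
      simp only [lab] at this
      rw [this])
  rw [degOn, degOn, sum_cycle_eq m S.1, sum_cycle_eq m T.1, key]
  simp only [ite_degOn hS, ite_degOn hT', ← hab, locDeg, lab]
  split_ifs <;> ring

theorem deg_sub_deg {m : Fin D.n} {S T : D.EnhancedState} (hT : T.1 = D.toggle m S.1)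
    (hST : AgreeAway m S T) : deg T - deg S = locDeg m T - locDeg m S := by
  have h : ∀ s : Setoid D.Pt, Saturated Set.univ s := fun s p q _ => by simp
  rw [← degOn_univ, ← degOn_univ, degOn_sub_degOn hT hST (h _) (h _) (by simp)]
  simp

/-! ### The maps of the edges of the cube -/

open scoped Classical in
/-- The coefficients, without signs, of the map that belongs to a change of the smoothing at `m` in
either direction. The products and coproducts of labels are exactly the transitions
that lower the degree by one. -/
noncomputable def flipCoeff (m : Fin D.n) (S T : D.EnhancedState) : ℚ :=
  if T.1 = D.toggle m S.1 ∧ AgreeAway m S T ∧ deg T + 1 = deg S then 1 else 0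

/-- The sign of the edge of the cube in the direction `m` at the state `α`. -/
noncomputable def cubeSign (m : Fin D.n) (α : D.State) : ℚ :=
  (-1) ^ (Finset.univ.filter fun c => c < m ∧ α c = true).card

theorem toggle_of_false {m : Fin D.n} {α : D.State} (h : α m = false) :
    D.toggle m α = Function.update α m true := by
  simp [toggle, h]

theorem edgeCoeff_eq (halt : D.Alternating) (m : Fin D.n) (S T : D.EnhancedState) :
    edgeCoeff m S T = if S.1 m = false then cubeSign m S.1 * flipCoeff m S T else 0 := by
  classical
  by_cases h0 : S.1 m = false
  swap
  · rw [edgeCoeff, if_neg (fun h => h0 h.1), if_neg h0]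
  rw [if_pos h0, edgeCoeff, flipCoeff, toggle_of_false h0]
  by_cases h1 : T.1 = Function.update S.1 m true
  swap
  · rw [if_neg (fun h => h1 h.2.1), if_neg (fun h => h1 h.1), mul_zero]
  by_cases h2 : AgreeAway m S T
  swap
  · rw [if_neg (fun h => h2 h.2.2), if_neg (fun h => h2 h.2.1), mul_zero]
  rw [if_pos ⟨h0, h1, h2⟩, cubeSign]
  congr 1
  have h1' : T.1 = D.toggle m S.1 := by rw [h1, toggle_of_false h0]
  have hd : deg T + 1 = deg S ↔ locDeg m T + 1 = locDeg m S := by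
    have := deg_sub_deg h1' h2
    constructor <;> intro <;> linarith
  have ht := rel_toggle halt S.1 m
  rw [← h1'] at ht
  simp only [h1, h2, hd, true_and]
  unfold locDeg
  by_cases hr : D.rel S.1 (D.ptA m) (D.ptB m)
  · have hr' := ht.1 hr
    rw [if_neg (fun k => k hr), if_pos (show D.cyc T.1 (m, 0) ≠ D.cyc T.1 (m, 2) from hr')]
    change comulCoeff (lab S (D.ptA m)) (lab T (D.ptA m)) (lab T (D.ptB m)) = _
    simp only [hr, hr', if_true, if_false]
    cases lab S (D.ptA m) <;> cases lab T (D.ptA m) <;> cases lab T (D.ptB m) <;>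
      simp [comulCoeff, labDeg]
  · have hr' : D.rel T.1 (D.ptA m) (D.ptB m) := by tauto
    rw [if_pos (show D.cyc S.1 (m, 0) ≠ D.cyc S.1 (m, 2) from hr)]
    change mulCoeff (lab S (D.ptA m)) (lab S (D.ptB m)) (lab T (D.ptA m)) = _
    simp only [hr, hr', if_true, if_false]
    cases lab S (D.ptA m) <;> cases lab S (D.ptB m) <;> cases lab T (D.ptA m) <;>
      simp [mulCoeff, labDeg]

theorem flipCoeff_ne_zero {m : Fin D.n} {S T : D.EnhancedState} (h : flipCoeff m S T ≠ 0) :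
    T.1 = D.toggle m S.1 ∧ AgreeAway m S T ∧ deg T + 1 = deg S := by
  classical
  by_contra h'
  exact h (if_neg h')

theorem locDeg_of_flipCoeff {m : Fin D.n} {S T : D.EnhancedState} (h : flipCoeff m S T ≠ 0) :
    locDeg m T + 1 = locDeg m S := by
  obtain ⟨h1, h2, h3⟩ := flipCoeff_ne_zero h
  have := deg_sub_deg h1 h2
  linarith

theorem rel_of_not_away {m : Fin D.n} {α : D.State} {p : D.Pt} (h : ¬ Away m α p) :
    D.rel α p (D.ptA m) ∨ D.rel α p (D.ptB m) := by
  rw [away_iff] at h; tauto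

/-- The label `X` at a point cannot disappear. -/
theorem lab_of_flipCoeff (halt : D.Alternating) {m : Fin D.n} {S T : D.EnhancedState}
    (h : flipCoeff m S T ≠ 0) {p : D.Pt} (hp : lab S p = false) : lab T p = false := by
  obtain ⟨h1, h2, -⟩ := flipCoeff_ne_zero h
  have hl := locDeg_of_flipCoeff h
  by_cases ha : Away m S.1 p
  · rw [← agreeAway_iff.1 h2 p ha, hp]
  have ha' : ¬ Away m T.1 p := by rwa [h1, away_toggle]
  have ht := rel_toggle halt S.1 m
  rw [← h1] at ht
  classical
  unfold locDeg at hl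
  have hs : lab S (D.ptA m) = false ∨ lab S (D.ptB m) = false := by
    rcases rel_of_not_away ha with h | h <;> rw [lab_congr h] at hp
    · exact Or.inl hp
    · exact Or.inr hp
  have hs' : D.rel S.1 (D.ptA m) (D.ptB m) → lab S (D.ptA m) = lab S (D.ptB m) := lab_congr
  have ht' : D.rel T.1 (D.ptA m) (D.ptB m) → lab T (D.ptA m) = lab T (D.ptB m) := lab_congr
  suffices lab T (D.ptA m) = false ∧ lab T (D.ptB m) = false by
    rcases rel_of_not_away ha' with h | h <;> rw [lab_congr h]
    · exact this.1
    · exact this.2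
  by_cases hr : D.rel S.1 (D.ptA m) (D.ptB m)
  · have hr' := ht.1 hr
    simp only [hr, hr', if_true, if_false] at hl
    have := hs' hr
    cases hA : lab S (D.ptA m) <;> cases hC : lab T (D.ptA m) <;> cases hD : lab T (D.ptB m) <;>
      simp_all [labDeg]
  · have hr' : D.rel T.1 (D.ptA m) (D.ptB m) := by tauto
    simp only [hr, hr', if_true, if_false] at hl
    have := ht' hr'
    cases hA : lab S (D.ptA m) <;> cases hB : lab S (D.ptB m) <;> cases hC : lab T (D.ptA m) <;>
      simp_all [labDeg]

open scoped Classical in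
/-- The enhanced state with the other label on the cycle through `p`. -/
noncomputable def flipAt (p : D.Pt) (S : D.EnhancedState) : D.EnhancedState :=
  ⟨S.1, Function.update S.2 (D.cl S.1 p) (!S.2 (D.cl S.1 p))⟩

theorem lab_flipAt_of_rel {p q : D.Pt} {S : D.EnhancedState} (h : D.rel S.1 q p) :
    lab (flipAt p S) q = !lab S p := by
  simp [lab, flipAt, rel_iff.1 h]

theorem lab_flipAt_of_not {p q : D.Pt} {S : D.EnhancedState} (h : ¬ D.rel S.1 q p) :
    lab (flipAt p S) q = lab S q := by
  rw [rel_iff] at h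
  simp [lab, flipAt, h]

@[simp] theorem flipAt_fst (p : D.Pt) (S : D.EnhancedState) : (flipAt p S).1 = S.1 := rfl

@[simp] theorem lab_flipAt_self (p : D.Pt) (S : D.EnhancedState) :
    lab (flipAt p S) p = !lab S p := lab_flipAt_of_rel (Setoid.refl' _ _)

@[simp] theorem flipAt_flipAt (p : D.Pt) (S : D.EnhancedState) : flipAt p (flipAt p S) = S := by
  refine ext_lab rfl fun q => ?_
  by_cases h : D.rel S.1 q p
  · rw [lab_flipAt_of_rel (S := flipAt p S) h, lab_flipAt_self, Bool.not_not, lab_congr h]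
  · rw [lab_flipAt_of_not (S := flipAt p S) h, lab_flipAt_of_not h]

theorem flipAt_congr {p q : D.Pt} {S : D.EnhancedState} (h : D.rel S.1 p q) :
    flipAt p S = flipAt q S := by
  simp only [flipAt, rel_iff.1 h]

theorem flipAt_comm (p q : D.Pt) (S : D.EnhancedState) :
    flipAt p (flipAt q S) = flipAt q (flipAt p S) := by
  by_cases h : D.rel S.1 p q
  · rw [flipAt_congr h, flipAt_congr (S := flipAt q S) (p := p) (q := q) h]
  · have h' : ¬ D.rel S.1 q p := fun k => h (Setoid.symm' _ k)
    refine ext_lab rfl fun x => ?_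
    by_cases hx : D.rel S.1 x p
    · have hy : ¬ D.rel S.1 x q := fun hy => h (Setoid.trans' _ (Setoid.symm' _ hx) hy)
      rw [lab_flipAt_of_rel (S := flipAt q S) hx, lab_flipAt_of_not (S := flipAt p S) hy,
        lab_flipAt_of_not h, lab_flipAt_of_rel hx]
    · rw [lab_flipAt_of_not (S := flipAt q S) hx]
      by_cases hy : D.rel S.1 x q
      · rw [lab_flipAt_of_rel (S := flipAt p S) hy, lab_flipAt_of_rel hy, lab_flipAt_of_not h']
      · rw [lab_flipAt_of_not (S := flipAt p S) hy, lab_flipAt_of_not hy, lab_flipAt_of_not hx]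

theorem degOn_flipAt {W : Set D.Pt} {S : D.EnhancedState} (hW : Saturated W (D.rel S.1))
    (p : D.Pt) [Decidable (p ∈ W)] :
    degOn W (flipAt p S) = degOn W S - if p ∈ W then 2 * labDeg (lab S p) else 0 := by
  classical
  have e : ∀ z : D.Cycle S.1, (if ∃ p ∈ W, D.cl S.1 p = z then labDeg ((flipAt p S).2 z) else 0) =
      (if ∃ p ∈ W, D.cl S.1 p = z then labDeg (S.2 z) else 0) -
        if z = D.cl S.1 p then (if p ∈ W then 2 * labDeg (lab S p) else 0) else 0 := by
    intro z
    by_cases hz : z = D.cl S.1 p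
    · subst hz
      simp only [ite_degOn hW, flipAt, Function.update_self, if_true, lab]
      cases S.2 (D.cl S.1 p) <;> by_cases hp : p ∈ W <;> simp [hp, labDeg]
    · simp [flipAt, hz]
  have h : degOn W (flipAt p S) = ∑ z : D.Cycle S.1,
      if ∃ p ∈ W, D.cl S.1 p = z then labDeg ((flipAt p S).2 z) else 0 := rfl
  rw [h, Finset.sum_congr rfl fun z _ => e z, Finset.sum_sub_distrib, degOn]
  simp

theorem deg_flipAt (S : D.EnhancedState) (p : D.Pt) :
    deg (flipAt p S) = deg S - 2 * labDeg (lab S p) := by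
  classical
  rw [← degOn_univ, degOn_flipAt (fun p q _ => by simp), ← degOn_univ]
  simp

/-! ### Operators on the total chain space -/

/-- The direct sum of all chain groups. The value of a chain at an enhanced state is the
coefficient of the latter. -/
abbrev Total (D : LinkDiagram) : Type := D.EnhancedState → ℚ

noncomputable instance : Fintype D.EnhancedState := Fintype.ofFinite _

open scoped Classical in
/-- A basis vector of the total chain space. -/
noncomputable def basis (S : D.EnhancedState) : Total D := Pi.single S 1

open scoped Classical in
theorem basis_apply (S T : D.EnhancedState) : basis S T = if T = S then 1 else 0 := by
  rw [basis, Pi.single_apply]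

theorem eq_sum_basis (y : Total D) : y = ∑ S, y S • basis S := by
  classical
  funext T
  simp [Finset.sum_apply, basis_apply]

/-- Two linear maps that agree on the basis vectors in the support of `y` agree at `y`. -/
theorem map_eq_of_basis {F G : Total D →ₗ[ℚ] Total D} {y : Total D}
    (h : ∀ S, y S ≠ 0 → F (basis S) = G (basis S)) : F y = G y := by
  rw [eq_sum_basis y, map_sum, map_sum]
  refine Finset.sum_congr rfl fun S _ => ?_
  rw [map_smul, map_smul]
  by_cases hS : y S = 0
  · rw [hS, zero_smul, zero_smul]
  · rw [h S hS]

/-- The unsigned map of all edges of the cube of resolutions in the direction `m`, in both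
directions. -/
noncomputable def edgeMap (m : Fin D.n) : Total D →ₗ[ℚ] Total D :=
  Matrix.mulVecLin (Matrix.of fun T S => flipCoeff m S T)

theorem edgeMap_apply (m : Fin D.n) (y : Total D) (T : D.EnhancedState) :
    edgeMap m y T = ∑ S, flipCoeff m S T * y S := by
  simp [edgeMap, Matrix.mulVec, dotProduct]

/-- Multiplication by `X` on the tensor factor of the cycle through `p`. -/
noncomputable def mulX (p : D.Pt) : Total D →ₗ[ℚ] Total D where
  toFun y T := if lab T p = false then y (flipAt p T) else 0
  map_add' y z := by funext T; simp only [Pi.add_apply]; split_ifs <;> simp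
  map_smul' r y := by funext T; simp only [Pi.smul_apply, RingHom.id_apply]; split_ifs <;> simp

/-- The map with `1 ↦ 0` and `X ↦ 1` on the tensor factor of the cycle through `p`. -/
noncomputable def delX (p : D.Pt) : Total D →ₗ[ℚ] Total D where
  toFun y T := if lab T p = true then y (flipAt p T) else 0
  map_add' y z := by funext T; simp only [Pi.add_apply]; split_ifs <;> simp
  map_smul' r y := by funext T; simp only [Pi.smul_apply, RingHom.id_apply]; split_ifs <;> simp

theorem mulX_apply (p : D.Pt) (y : Total D) (T : D.EnhancedState) :
    mulX p y T = if lab T p = false then y (flipAt p T) else 0 := rfl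

theorem delX_apply (p : D.Pt) (y : Total D) (T : D.EnhancedState) :
    delX p y T = if lab T p = true then y (flipAt p T) else 0 := rfl

/-- The diagonal operator with the entries `f`. -/
noncomputable def diagOp (f : D.EnhancedState → ℚ) : Total D →ₗ[ℚ] Total D where
  toFun y T := f T * y T
  map_add' y z := by funext T; simp [mul_add]
  map_smul' r y := by funext T; simp; ring

theorem diagOp_apply (f : D.EnhancedState → ℚ) (y : Total D) (T : D.EnhancedState) :
    diagOp f y T = f T * y T := rfl

theorem mulX_comm (p q : D.Pt) (y : Total D) : mulX p (mulX q y) = mulX q (mulX p y) := by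
  funext T
  simp only [mulX_apply]
  rw [flipAt_comm]
  by_cases h : D.rel T.1 p q
  · have h' := Setoid.symm' _ h
    rw [lab_flipAt_of_rel h, lab_flipAt_of_rel h', lab_congr h]
  · have h' : ¬ D.rel T.1 q p := fun k => h (Setoid.symm' _ k)
    rw [lab_flipAt_of_not h, lab_flipAt_of_not h']
    split_ifs <;> rfl

theorem mulX_basis {p : D.Pt} {S : D.EnhancedState} (h : lab S p = true) :
    mulX p (basis S) = basis (flipAt p S) := by
  classical
  funext T
  rw [mulX_apply, basis_apply, basis_apply]
  by_cases hT : T = flipAt p S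
  · subst hT
    simp [h]
  · have : flipAt p T ≠ S := fun e => hT (by rw [← e, flipAt_flipAt])
    simp [hT, this]

theorem mulX_basis_of_false {p : D.Pt} {S : D.EnhancedState} (h : lab S p = false) :
    mulX p (basis S) = 0 := by
  classical
  funext T
  rw [mulX_apply, basis_apply]
  by_cases hT : flipAt p T = S
  · rw [← hT] at h
    simp at h
    simp [h]
  · simp [hT]

theorem delX_basis {p : D.Pt} {S : D.EnhancedState} (h : lab S p = false) :
    delX p (basis S) = basis (flipAt p S) := by
  classical
  funext T
  rw [delX_apply, basis_apply, basis_apply]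
  by_cases hT : T = flipAt p S
  · subst hT
    simp [h]
  · have : flipAt p T ≠ S := fun e => hT (by rw [← e, flipAt_flipAt])
    simp [hT, this]

theorem delX_basis_of_true {p : D.Pt} {S : D.EnhancedState} (h : lab S p = true) :
    delX p (basis S) = 0 := by
  classical
  funext T
  rw [delX_apply, basis_apply]
  by_cases hT : flipAt p T = S
  · rw [← hT] at h
    simp at h
    simp [h]
  · simp [hT]

theorem diagOp_basis (f : D.EnhancedState → ℚ) (S : D.EnhancedState) :
    diagOp f (basis S) = f S • basis S := by
  classical
  funext T
  rw [diagOp_apply, Pi.smul_apply, basis_apply, smul_eq_mul]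
  split_ifs with h
  · rw [h]
  · simp

theorem mulX_basis_congr {p q : D.Pt} {S : D.EnhancedState} (h : D.rel S.1 p q) :
    mulX p (basis S) = mulX q (basis S) := by
  have e := lab_congr h
  cases hp : lab S p
  · rw [mulX_basis_of_false hp, mulX_basis_of_false (e ▸ hp)]
  · rw [mulX_basis hp, mulX_basis (e ▸ hp), flipAt_congr h]

theorem delX_mulX_add (p : D.Pt) (y : Total D) : delX p (mulX p y) + mulX p (delX p y) = y := by
  funext T
  simp only [Pi.add_apply, delX_apply, mulX_apply, lab_flipAt_self, flipAt_flipAt]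
  cases lab T p <;> simp

/-- The edge maps are linear over the algebra generated by the operators `mulX`. -/
theorem edgeMap_mulX (halt : D.Alternating) (m : Fin D.n) (p : D.Pt) (y : Total D) :
    edgeMap m (mulX p y) = mulX p (edgeMap m y) := by
  classical
  funext T
  rw [edgeMap_apply, mulX_apply, edgeMap_apply]
  rw [← Equiv.sum_comp (Function.Involutive.toPerm (flipAt p) (flipAt_flipAt p))]
  have key : ∀ S, flipCoeff m (flipAt p S) T * mulX p y (flipAt p S) =
      if lab T p = false then flipCoeff m S (flipAt p T) * y S else 0 := by
    intro S
    rw [mulX_apply, lab_flipAt_self, flipAt_flipAt]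
    cases hS : lab S p
    · simp only [Bool.not_false, Bool.true_eq_false, if_false, mul_zero]
      split_ifs with hT
      · -- The label `X` of `S` at `p` cannot disappear.
        have : flipCoeff m S (flipAt p T) = 0 := by
          by_contra h
          have := lab_of_flipCoeff halt h hS
          rw [lab_flipAt_self, hT] at this
          cases this
        rw [this, zero_mul]
      · rfl
    · simp only [Bool.not_true, if_true]
      cases hT : lab T p
      · simp only [if_true]
        congr 1
        unfold flipCoeff
        refine if_congr ?_ rfl rfl
        rw [deg_flipAt, deg_flipAt, hS, hT, agreeAway_iff, agreeAway_iff]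
        simp only [flipAt_fst]
        refine and_congr_right fun h1 => and_congr ?_ ?_
        · refine forall_congr' fun q => forall_congr' fun hq => ?_
          by_cases hqp : D.rel S.1 q p
          · have hqp' : D.rel T.1 q p := by rwa [h1, rel_toggle_of_away hq]
            rw [lab_flipAt_of_rel hqp, lab_flipAt_of_rel hqp', hS, lab_congr hqp, hS,
              lab_congr hqp', hT]
            simp
          · have hqp' : ¬ D.rel T.1 q p := by rwa [h1, rel_toggle_of_away hq]
            rw [lab_flipAt_of_not hqp, lab_flipAt_of_not hqp']
        · simp only [labDeg]
          constructor <;> intro h <;> simp at h ⊢ <;> linarith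
      · have : flipCoeff m (flipAt p S) T = 0 := by
          by_contra h
          have := lab_of_flipCoeff halt h (p := p) (by rw [lab_flipAt_self, hS]; rfl)
          rw [hT] at this
          cases this
        rw [this]; simp
  refine (Finset.sum_congr rfl fun S _ => key S).trans ?_
  split_ifs <;> simp

/-- The enhanced state over `α` all of whose labels are `1`. -/
def unitState (α : D.State) : D.EnhancedState := ⟨α, fun _ => true⟩

theorem eq_unitState_iff {α : D.State} {S : D.EnhancedState} :
    S = unitState α ↔ S.1 = α ∧ ∀ p, lab S p = true := by
  constructor
  · rintro rfl; exact ⟨rfl, fun _ => rfl⟩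
  · rintro ⟨h, h'⟩; exact ext_lab h fun p => h' p

theorem edgeMap_basis (m : Fin D.n) (S T : D.EnhancedState) :
    edgeMap m (basis S) T = flipCoeff m S T := by
  classical
  rw [edgeMap_apply]
  simp [basis_apply]

theorem locDeg_unitState_of_rel {m : Fin D.n} {α : D.State} (h : D.rel α (D.ptA m) (D.ptB m)) :
    locDeg m (unitState α) = 1 := by
  classical
  rw [locDeg, if_pos (show D.rel (unitState α).1 _ _ from h)]; rfl

theorem locDeg_unitState_of_not {m : Fin D.n} {α : D.State} (h : ¬ D.rel α (D.ptA m) (D.ptB m)) :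
    locDeg m (unitState α) = 2 := by
  classical
  rw [locDeg, if_neg (show ¬ D.rel (unitState α).1 _ _ from h)]; rfl

/-- If two cycles merge, the product of two units is the unit. -/
theorem edgeMap_unit_of_not (halt : D.Alternating) {m : Fin D.n} {α : D.State}
    (h : ¬ D.rel α (D.ptA m) (D.ptB m)) :
    edgeMap m (basis (unitState α)) = basis (unitState (D.toggle m α)) := by
  classical
  have hr := rel_toggle_of_not halt h
  funext T
  rw [edgeMap_basis, basis_apply, flipCoeff]
  refine if_congr ?_ rfl rfl
  rw [eq_unitState_iff]
  refine and_congr_right fun h1 => ?_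
  rw [agreeAway_iff]
  have hr' : D.rel T.1 (D.ptA m) (D.ptB m) := h1 ▸ hr
  have hT : locDeg m T = labDeg (lab T (D.ptA m)) := by rw [locDeg, if_pos hr', add_zero]
  constructor
  · rintro ⟨h2, h3⟩ p
    have := deg_sub_deg (S := unitState α) h1 (agreeAway_iff.2 h2)
    rw [locDeg_unitState_of_not h, hT] at this
    have hA : lab T (D.ptA m) = true := by
      cases hA : lab T (D.ptA m)
      · rw [hA, labDeg] at this; simp at this; linarith
      · rfl
    by_cases ha : Away m α p
    · exact (h2 p ha).symm
    · have ha' : ¬ Away m T.1 p := by rwa [h1, away_toggle]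
      rcases rel_of_not_away ha' with k | k <;> rw [lab_congr k]
      · exact hA
      · rw [← lab_congr hr', hA]
  · intro h2
    have h3 : ∀ p, Away m (unitState α).1 p → lab (unitState α) p = lab T p :=
      fun p _ => (h2 p).symm
    refine ⟨h3, ?_⟩
    have := deg_sub_deg (S := unitState α) h1 (agreeAway_iff.2 h3)
    rw [locDeg_unitState_of_not h, hT, h2, labDeg] at this
    simp at this
    linarith

/-- If a cycle splits, the coproduct of the unit is the sum of `X ⊗ 1` and `1 ⊗ X`. -/
theorem edgeMap_unit_of_rel (halt : D.Alternating) {m : Fin D.n} {α : D.State}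
    (h : D.rel α (D.ptA m) (D.ptB m)) :
    edgeMap m (basis (unitState α)) = mulX (D.ptA m) (basis (unitState (D.toggle m α))) +
      mulX (D.ptB m) (basis (unitState (D.toggle m α))) := by
  classical
  have hr := (rel_toggle halt α m).1 h
  rw [mulX_basis rfl, mulX_basis rfl]
  funext T
  rw [edgeMap_basis, Pi.add_apply, basis_apply, basis_apply, flipCoeff]
  by_cases h1 : T.1 = D.toggle m α
  swap
  · rw [if_neg (fun k => h1 k.1), if_neg (fun k => h1 (by rw [k]; rfl)),
      if_neg (fun k => h1 (by rw [k]; rfl)), add_zero]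
  have hr' : ¬ D.rel T.1 (D.ptA m) (D.ptB m) := h1 ▸ hr
  have hrs : ¬ D.rel T.1 (D.ptB m) (D.ptA m) := fun k => hr' (Setoid.symm' _ k)
  have hflip : ∀ p, T = flipAt p (unitState (D.toggle m α)) ↔
      flipAt p T = unitState (D.toggle m α) := fun p =>
    ⟨fun e => by rw [e, flipAt_flipAt], fun e => by rw [← e, flipAt_flipAt]⟩
  have hT : locDeg m T = labDeg (lab T (D.ptA m)) + labDeg (lab T (D.ptB m)) := by
    rw [locDeg, if_neg hr']
  have haw : ∀ q, Away m α q → ¬ D.rel T.1 q (D.ptA m) ∧ ¬ D.rel T.1 q (D.ptB m) := by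
    intro q hq
    rw [← away_iff, h1, away_toggle]; exact hq
  simp only [hflip, eq_unitState_iff, flipAt_fst, h1, true_and]
  by_cases h2 : AgreeAway m (unitState α) T
  · have hdeg : deg T + 1 = deg (unitState α) ↔ locDeg m T = 0 := by
      have := deg_sub_deg (S := unitState α) h1 h2
      rw [locDeg_unitState_of_rel h] at this
      constructor <;> intro <;> linarith
    rw [agreeAway_iff] at h2
    have hA : (∀ p, lab (flipAt (D.ptA m) T) p = true) ↔
        lab T (D.ptA m) = false ∧ lab T (D.ptB m) = true := by
      constructor
      · intro H
        have e1 := H (D.ptA m)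
        have e2 := H (D.ptB m)
        rw [lab_flipAt_self] at e1
        rw [lab_flipAt_of_not hrs] at e2
        exact ⟨by simpa using e1, e2⟩
      · rintro ⟨e1, e2⟩ q
        by_cases hq : Away m α q
        · rw [lab_flipAt_of_not (haw q hq).1, ← h2 q hq]; rfl
        · have hq' : ¬ Away m T.1 q := by rwa [h1, away_toggle]
          rcases rel_of_not_away hq' with k | k
          · rw [lab_flipAt_of_rel k, e1]; rfl
          · rw [lab_congr (S := flipAt (D.ptA m) T) k, lab_flipAt_of_not hrs, e2]
    have hB : (∀ p, lab (flipAt (D.ptB m) T) p = true) ↔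
        lab T (D.ptB m) = false ∧ lab T (D.ptA m) = true := by
      constructor
      · intro H
        have e1 := H (D.ptB m)
        have e2 := H (D.ptA m)
        rw [lab_flipAt_self] at e1
        rw [lab_flipAt_of_not hr'] at e2
        exact ⟨by simpa using e1, e2⟩
      · rintro ⟨e1, e2⟩ q
        by_cases hq : Away m α q
        · rw [lab_flipAt_of_not (haw q hq).2, ← h2 q hq]; rfl
        · have hq' : ¬ Away m T.1 q := by rwa [h1, away_toggle]
          rcases rel_of_not_away hq' with k | k
          · rw [lab_congr (S := flipAt (D.ptB m) T) k, lab_flipAt_of_not hr', e2]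
          · rw [lab_flipAt_of_rel k, e1]; rfl
    simp only [agreeAway_iff.2 h2, hdeg, hT, hA, hB, true_and]
    cases lab T (D.ptA m) <;> cases lab T (D.ptB m) <;> simp [labDeg, unitState]
  · have key : ∀ p, (∀ q, Away m α q → ¬ D.rel T.1 q p) →
        ¬ ∀ q, lab (flipAt p T) q = true := by
      intro p hp H
      refine h2 (agreeAway_iff.2 fun q hq => ?_)
      have := H q
      rw [lab_flipAt_of_not (hp q hq)] at this
      rw [this]; rfl
    rw [if_neg (fun k => h2 k.2.1), if_neg (key _ fun q hq => (haw q hq).1),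
      if_neg (key _ fun q hq => (haw q hq).2), add_zero]

theorem deg_le_cycleCount (S : D.EnhancedState) : deg S ≤ cycleCount S.1 := by
  refine (Finset.sum_le_card_nsmul _ _ 1 fun z _ => ?_).trans (by simp [cycleCount])
  unfold labDeg; split_ifs <;> simp

/-- Every enhanced state over `α` arises from one whose labels on the set `Q` are `1` by turning
labels `1` on `Q` into `X`. -/
theorem label_induction {α : D.State} (Q : Set D.Pt) {motive : D.EnhancedState → Prop}
    (base : ∀ S, S.1 = α → (∀ p ∈ Q, lab S p = true) → motive S)
    (step : ∀ S p, S.1 = α → p ∈ Q → lab S p = true → motive S → motive (flipAt p S)) :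
    ∀ S, S.1 = α → motive S := by
  classical
  intro S
  -- Changing a label `X` back into `1` raises the degree, which is bounded.
  induction hN : ((cycleCount S.1 : ℤ) - deg S).toNat using Nat.strong_induction_on
    generalizing S with
  | _ N ih =>
    intro hS
    by_cases h : ∀ p ∈ Q, lab S p = true
    · exact base S hS h
    · push Not at h
      obtain ⟨p, hp, hl⟩ := h
      have hl' : lab S p = false := by simpa using hl
      rw [← flipAt_flipAt p S]
      refine step _ p hS hp (by rw [lab_flipAt_self, hl']; rfl) (ih _ ?_ _ rfl hS)
      have h1 := deg_flipAt S p
      have h2 := deg_le_cycleCount (flipAt p S)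
      rw [hl', labDeg] at h1
      simp only [Bool.false_eq_true, if_false] at h1
      rw [flipAt_fst] at h2 ⊢
      omega

/-- Linear maps that commute with the operators `mulX` are determined by their values on units. -/
theorem map_eq_of_unit {F G : Total D →ₗ[ℚ] Total D}
    (hF : ∀ p y, F (mulX p y) = mulX p (F y)) (hG : ∀ p y, G (mulX p y) = mulX p (G y))
    (h : ∀ α, F (basis (unitState α)) = G (basis (unitState α))) (y : Total D) : F y = G y := by
  refine map_eq_of_basis fun S _ => ?_
  refine label_induction Set.univ (motive := fun S => F (basis S) = G (basis S)) (fun S hS hl => ?_)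
    (fun S p _ _ hp ih => ?_) S rfl
  · rw [eq_unitState_iff.2 ⟨rfl, fun p => hl p trivial⟩]; exact h _
  · rw [← mulX_basis hp, hF, hG, ih]

open scoped Classical in
/-- The element by which the edge map in the direction `m` multiplies units: `1` for a product and
the sum of the two `X` for a coproduct. -/
noncomputable def edgeFactor (m : Fin D.n) (α : D.State) : Total D →ₗ[ℚ] Total D :=
  if D.rel α (D.ptA m) (D.ptB m) then mulX (D.ptA m) + mulX (D.ptB m) else LinearMap.id

theorem edgeMap_unit (halt : D.Alternating) (m : Fin D.n) (α : D.State) :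
    edgeMap m (basis (unitState α)) = edgeFactor m α (basis (unitState (D.toggle m α))) := by
  classical
  unfold edgeFactor
  split_ifs with h
  · rw [edgeMap_unit_of_rel halt h]; rfl
  · rw [edgeMap_unit_of_not halt h]; rfl

theorem edgeMap_edgeFactor (halt : D.Alternating) (m m' : Fin D.n) (α : D.State) (y : Total D) :
    edgeMap m' (edgeFactor m α y) = edgeFactor m α (edgeMap m' y) := by
  classical
  unfold edgeFactor
  split_ifs with h
  · simp only [LinearMap.add_apply, map_add, edgeMap_mulX halt]
  · rfl

/-- The faces of the cube of resolutions commute. -/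
theorem edgeMap_comm (halt : D.Alternating) {m m' : Fin D.n} (hm : m ≠ m') (y : Total D) :
    edgeMap m (edgeMap m' y) = edgeMap m' (edgeMap m y) := by
  classical
  refine map_eq_of_unit (F := edgeMap m ∘ₗ edgeMap m') (G := edgeMap m' ∘ₗ edgeMap m)
    (fun p y => by simp [edgeMap_mulX halt]) (fun p y => by simp [edgeMap_mulX halt])
    (fun α => ?_) y
  simp only [LinearMap.comp_apply, edgeMap_unit halt, edgeMap_edgeFactor halt]
  rw [toggle_comm hm]
  set γ := D.toggle m' (D.toggle m α) with hγ
  have hγ' : γ = D.toggle m (D.toggle m' α) := (toggle_comm hm α).symm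
  -- Counting cycles, the two paths around the face have the same number of coproducts.
  have c1 := fun h => cycleCount_toggle_of_rel halt (α := α) (m := m) h
  have c2 := fun h => cycleCount_toggle_of_not halt (α := α) (m := m) h
  have c3 := fun h => cycleCount_toggle_of_rel halt (α := D.toggle m α) (m := m') h
  have c4 := fun h => cycleCount_toggle_of_not halt (α := D.toggle m α) (m := m') h
  have d1 := fun h => cycleCount_toggle_of_rel halt (α := α) (m := m') h
  have d2 := fun h => cycleCount_toggle_of_not halt (α := α) (m := m') h
  have d3 := fun h => cycleCount_toggle_of_rel halt (α := D.toggle m' α) (m := m) h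
  have d4 := fun h => cycleCount_toggle_of_not halt (α := D.toggle m' α) (m := m) h
  rw [← hγ] at c3 c4
  rw [← hγ'] at d3 d4
  have t1 := rel_toggle halt (D.toggle m α) m'
  have t2 := rel_toggle halt (D.toggle m' α) m
  rw [← hγ] at t1
  rw [← hγ'] at t2
  have g1 := glue_toggle (D.toggle m α) m'
  rw [← hγ] at g1
  have congrX : ∀ {p q : D.Pt}, D.rel γ p q →
      mulX p (basis (unitState γ)) = mulX q (basis (unitState γ)) := fun h =>
    mulX_basis_congr (S := unitState γ) h
  unfold edgeFactor
  by_cases h1 : D.rel α (D.ptA m) (D.ptB m) <;>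
  by_cases h2 : D.rel (D.toggle m α) (D.ptA m') (D.ptB m') <;>
  by_cases h3 : D.rel α (D.ptA m') (D.ptB m') <;>
  by_cases h4 : D.rel (D.toggle m' α) (D.ptA m) (D.ptB m) <;>
  simp only [h1, h2, h3, h4, if_true, if_false, LinearMap.id_apply, LinearMap.add_apply, map_add,
    not_true_eq_false, not_false_eq_true, forall_const, false_imp_iff, true_iff, false_iff,
    not_not] at c1 c2 c3 c4 d1 d2 d3 d4 t1 t2 ⊢ <;>
  try omega
  · rw [mulX_comm (D.ptA m') (D.ptA m), mulX_comm (D.ptB m') (D.ptA m),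
      mulX_comm (D.ptA m') (D.ptB m), mulX_comm (D.ptB m') (D.ptB m)]
    abel
  · -- Both paths split one cycle and merge the pieces again, so that all points are on one cycle.
    have hle : D.rel (D.toggle m α) ≤ D.rel γ := by
      rw [hγ, rel_toggle_eq_glue halt h2]; exact Setoid.le_glue _ _ _
    have ha : ¬ Away m α (D.ptA m') := fun h => h2 ((rel_toggle_of_away h).2 h3)
    rw [← away_toggle] at ha
    have hA : D.rel γ (D.ptA m') (D.ptA m) := by
      rcases rel_of_not_away ha with h | h
      · exact hle h
      · exact Setoid.trans' _ (hle h) (Setoid.symm' _ t2)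
    rw [← congrX t1, ← congrX t2, congrX hA]
  · -- Both paths merge the same two cycles and split the result again.
    rw [Setoid.glue_eq_self h2] at g1
    have hAB : (D.rel γ).glue (D.ptA m') (D.ptB m') (D.ptA m) (D.ptB m) := by
      rw [g1]; exact rel_toggle_of_not halt h1
    rcases hAB with h | ⟨h, h'⟩ | ⟨h, h'⟩
    · exact absurd h t2
    · rw [congrX h, congrX h']
    · rw [congrX h, congrX h', add_comm]

/-! ### Signed edge maps and partial differentials -/

theorem ne_zero_of_edgeMap {m : Fin D.n} {y : Total D} {T : D.EnhancedState}
    (h : edgeMap m y T ≠ 0) : ∃ S, y S ≠ 0 ∧ flipCoeff m S T ≠ 0 := by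
  rw [edgeMap_apply] at h
  obtain ⟨S, _, hS⟩ := Finset.exists_ne_zero_of_sum_ne_zero h
  exact ⟨S, right_ne_zero_of_mul hS, left_ne_zero_of_mul hS⟩

theorem diagOp_edgeMap (f : D.State → ℚ) (m : Fin D.n) (y : Total D) :
    diagOp (fun S => f S.1) (edgeMap m y) =
      edgeMap m (diagOp (fun S => f (D.toggle m S.1)) y) := by
  funext T
  rw [diagOp_apply, edgeMap_apply, edgeMap_apply, Finset.mul_sum]
  refine Finset.sum_congr rfl fun S _ => ?_
  rw [diagOp_apply]
  by_cases h : flipCoeff m S T = 0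
  · rw [h]; ring
  · rw [(flipCoeff_ne_zero h).1]; ring

theorem diagOp_comm (f g : D.EnhancedState → ℚ) (y : Total D) :
    diagOp f (diagOp g y) = diagOp g (diagOp f y) := by
  funext T; simp only [diagOp_apply]; ring

theorem cubeSign_mul_self (m : Fin D.n) (α : D.State) : cubeSign m α * cubeSign m α = 1 := by
  rw [cubeSign, ← mul_pow]; simp

theorem cubeSign_toggle_of_not_lt {m c : Fin D.n} (h : ¬ c < m) (α : D.State) :
    cubeSign m (D.toggle c α) = cubeSign m α := by
  unfold cubeSign
  congr 2
  refine Finset.filter_congr fun x _ => and_congr_right fun hx => ?_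
  rw [toggle_of_ne (by rintro rfl; exact h hx)]

theorem cubeSign_toggle_of_lt {m c : Fin D.n} (h : c < m) (α : D.State) :
    cubeSign m (D.toggle c α) = -cubeSign m α := by
  have key : ∀ α : D.State, α c = false → cubeSign m (D.toggle c α) = -cubeSign m α := by
    intro α hα
    have : (Finset.univ.filter fun x => x < m ∧ D.toggle c α x = true) =
        insert c (Finset.univ.filter fun x => x < m ∧ α x = true) := by
      ext x
      by_cases hx : x = c
      · subst hx; simp [h, hα]
      · simp [toggle_of_ne hx, hx]
    rw [cubeSign, cubeSign, this, Finset.card_insert_of_notMem (by simp [hα]), pow_succ]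
    ring
  cases hα : α c
  · exact key α hα
  · have := key (D.toggle c α) (by simp [hα])
    rw [toggle_toggle] at this
    rw [this, neg_neg]

open scoped Classical in
/-- The sign of an edge of the cube that starts at a smoothing `b`, and zero for the other edges. -/
noncomputable def faceSign (b : Bool) (m : Fin D.n) (α : D.State) : ℚ :=
  if α m = b then cubeSign m α else 0

/-- The signed edge map in the direction `m`, restricted to the states whose smoothing at `m` is
`b`. For `b = false` this is a part of the Khovanov differential. -/
noncomputable def signedMap (b : Bool) (m : Fin D.n) : Total D →ₗ[ℚ] Total D :=
  edgeMap m ∘ₗ diagOp (fun S => faceSign b m S.1)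

theorem signedMap_eq (b : Bool) (m : Fin D.n) (y : Total D) : signedMap b m y =
    edgeMap m (diagOp (fun S => faceSign b m S.1) y) := rfl

theorem signedMap_anticomm (halt : D.Alternating) {m m' : Fin D.n} (h : m ≠ m') (b b' : Bool)
    (y : Total D) : signedMap b m (signedMap b' m' y) = -signedMap b' m' (signedMap b m y) := by
  simp only [signedMap_eq]
  rw [diagOp_edgeMap, diagOp_edgeMap, edgeMap_comm halt h, ← map_neg, ← map_neg]
  congr 2
  funext T
  simp only [diagOp_apply, Pi.neg_apply, faceSign, toggle_of_ne h, toggle_of_ne h.symm]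
  rcases lt_or_gt_of_ne h with hlt | hlt
  · rw [cubeSign_toggle_of_lt hlt, cubeSign_toggle_of_not_lt (not_lt.2 hlt.le)]
    split_ifs <;> ring
  · rw [cubeSign_toggle_of_lt hlt, cubeSign_toggle_of_not_lt (not_lt.2 hlt.le)]
    split_ifs <;> ring

theorem ne_zero_of_signedMap {b : Bool} {m : Fin D.n} {y : Total D} {T : D.EnhancedState}
    (h : signedMap b m y T ≠ 0) : ∃ S, y S ≠ 0 ∧ S.1 m = b ∧ flipCoeff m S T ≠ 0 := by
  obtain ⟨S, hS, hf⟩ := ne_zero_of_edgeMap h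
  rw [diagOp_apply] at hS
  refine ⟨S, right_ne_zero_of_mul hS, ?_, hf⟩
  by_contra hb
  rw [faceSign, if_neg hb, zero_mul] at hS
  exact hS rfl

theorem signedMap_self (b : Bool) (m : Fin D.n) (y : Total D) :
    signedMap b m (signedMap b m y) = 0 := by
  funext T
  by_contra h
  obtain ⟨S, hS, hb, -⟩ := ne_zero_of_signedMap h
  obtain ⟨R, -, hb', hf⟩ := ne_zero_of_signedMap hS
  rw [(flipCoeff_ne_zero hf).1, toggle_self, hb'] at hb
  simp at hb

/-- The part of the Khovanov differential that belongs to the crossings in `U`. -/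
noncomputable def partialDiff (U : Finset (Fin D.n)) : Total D →ₗ[ℚ] Total D :=
  ∑ m ∈ U, signedMap false m

theorem partialDiff_apply (U : Finset (Fin D.n)) (y : Total D) :
    partialDiff U y = ∑ m ∈ U, signedMap false m y := by
  rw [partialDiff, LinearMap.sum_apply]

theorem partialDiff_erase {U : Finset (Fin D.n)} {c : Fin D.n} (hc : c ∈ U) (y : Total D) :
    partialDiff U y = partialDiff (U.erase c) y + signedMap false c y := by
  rw [partialDiff_apply, partialDiff_apply, Finset.sum_erase_add _ _ hc]

theorem partialDiff_signedMap (halt : D.Alternating) {U : Finset (Fin D.n)} {c : Fin D.n}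
    (hc : c ∉ U) (b : Bool) (y : Total D) :
    partialDiff U (signedMap b c y) = -signedMap b c (partialDiff U y) := by
  rw [partialDiff_apply, partialDiff_apply, map_sum, ← Finset.sum_neg_distrib]
  refine Finset.sum_congr rfl fun m hm => signedMap_anticomm halt (by rintro rfl; exact hc hm) _ _ _

theorem partialDiff_partialDiff (halt : D.Alternating) (U : Finset (Fin D.n)) (y : Total D) :
    partialDiff U (partialDiff U y) = 0 := by
  have e : partialDiff U (partialDiff U y) =
      ∑ m ∈ U, ∑ m' ∈ U, signedMap false m (signedMap false m' y) := by
    rw [partialDiff_apply U (partialDiff U y), partialDiff_apply]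
    simp only [map_sum]
  have : partialDiff U (partialDiff U y) = -partialDiff U (partialDiff U y) := by
    conv_lhs => rw [e, Finset.sum_comm]
    rw [e, ← Finset.sum_neg_distrib]
    refine Finset.sum_congr rfl fun m _ => ?_
    rw [← Finset.sum_neg_distrib]
    refine Finset.sum_congr rfl fun m' _ => ?_
    by_cases h : m = m'
    · subst h; simp [signedMap_self]
    · exact signedMap_anticomm halt (fun k => h k.symm) _ _ _
  exact self_eq_neg.1 this

/-! ### The bigraded pieces of the subcubes -/

theorem ones_toggle (m : Fin D.n) (α : D.State) :
    (ones (D.toggle m α) : ℤ) = ones α + if α m then -1 else 1 := by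
  have key : ∀ α : D.State, α m = false → ones (D.toggle m α) = ones α + 1 := by
    intro α hα
    have : (Finset.univ.filter fun x => D.toggle m α x = true) =
        insert m (Finset.univ.filter fun x => α x = true) := by
      ext x
      by_cases hx : x = m
      · subst hx; simp [hα]
      · simp [toggle_of_ne hx, hx]
    rw [ones, ones, this, Finset.card_insert_of_notMem (by simp [hα])]
  cases hα : α m
  · simp [key α hα]
  · have := key (D.toggle m α) (by simp [hα])
    rw [toggle_toggle] at this
    rw [this]; simp

/-- The chains of degree `d` with `r` smoothings of type `1`, over the states that agree with `α`
outside `U`. -/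
def part (U : Finset (Fin D.n)) (α : D.State) (d r : ℤ) : Submodule ℚ (Total D) where
  carrier := {y | ∀ S, y S ≠ 0 → (∀ c ∉ U, S.1 c = α c) ∧ deg S = d ∧ (ones S.1 : ℤ) = r}
  zero_mem' := fun S h => absurd rfl h
  add_mem' := by
    intro y z hy hz S h
    by_cases hyS : y S = 0
    · exact hz S (fun e => h (by rw [Pi.add_apply, hyS, e, add_zero]))
    · exact hy S hyS
  smul_mem' := by
    intro a y hy S h
    exact hy S (fun e => h (by rw [Pi.smul_apply, e, smul_zero]))

theorem diagOp_mem {U : Finset (Fin D.n)} {α : D.State} {d r : ℤ} {y : Total D}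
    (hy : y ∈ part U α d r) (f : D.EnhancedState → ℚ) : diagOp f y ∈ part U α d r :=
  fun S hS => hy S (right_ne_zero_of_mul hS)

theorem delX_mem {U : Finset (Fin D.n)} {α : D.State} {d r : ℤ} {y : Total D}
    (hy : y ∈ part U α d r) (p : D.Pt) : delX p y ∈ part U α (d + 2) r := by
  intro S hS
  rw [delX_apply] at hS
  by_cases h : lab S p = true
  · rw [if_pos h] at hS
    obtain ⟨h1, h2, h3⟩ := hy _ hS
    rw [deg_flipAt, h, labDeg, if_pos rfl] at h2
    exact ⟨h1, by linarith, h3⟩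
  · rw [if_neg h] at hS
    exact absurd rfl hS

theorem signedMap_mem {U : Finset (Fin D.n)} {α : D.State} {d r : ℤ} {y : Total D}
    {m : Fin D.n} (hm : m ∈ U) (hy : y ∈ part U α d r) :
    signedMap false m y ∈ part U α (d - 1) (r + 1) := by
  intro T hT
  obtain ⟨S, hS, hb, hf⟩ := ne_zero_of_signedMap hT
  obtain ⟨h1, h2, h3⟩ := hy S hS
  obtain ⟨e1, -, e3⟩ := flipCoeff_ne_zero hf
  refine ⟨fun c hc => ?_, by linarith, ?_⟩
  · rw [e1, toggle_of_ne (by rintro rfl; exact hc hm), h1 c hc]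
  · rw [e1, ones_toggle, hb, h3]; rfl

theorem signedMap_mem_update {U : Finset (Fin D.n)} {α : D.State} {d r : ℤ} {y : Total D}
    {c : Fin D.n} {b : Bool} (hc : c ∉ U)
    (hy : y ∈ part U (Function.update α c b) d r) :
    signedMap b c y ∈
      part U (Function.update α c (!b)) (d - 1) (r + if b then -1 else 1) := by
  intro T hT
  obtain ⟨S, hS, hb, hf⟩ := ne_zero_of_signedMap hT
  obtain ⟨h1, h2, h3⟩ := hy S hS
  obtain ⟨e1, -, e3⟩ := flipCoeff_ne_zero hf
  refine ⟨fun x hx => ?_, by linarith, ?_⟩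
  · rw [e1]
    by_cases hxc : x = c
    · subst hxc; rw [toggle_self, hb]; simp
    · have := h1 x hx
      rw [toggle_of_ne hxc, this]
      simp [hxc]
  · rw [e1, ones_toggle, hb, h3]

theorem signedMap_false_mem {U : Finset (Fin D.n)} {α : D.State} {d r : ℤ} {y : Total D}
    {c : Fin D.n} (hc : c ∉ U) (hy : y ∈ part U (Function.update α c false) d r) :
    signedMap false c y ∈ part U (Function.update α c true) (d - 1) (r + 1) :=
  signedMap_mem_update hc hy

theorem signedMap_true_mem {U : Finset (Fin D.n)} {α : D.State} {d r : ℤ} {y : Total D}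
    {c : Fin D.n} (hc : c ∉ U) (hy : y ∈ part U (Function.update α c true) d r) :
    signedMap true c y ∈ part U (Function.update α c false) (d - 1) (r - 1) :=
  signedMap_mem_update hc hy

theorem mem_part_congr {U : Finset (Fin D.n)} {α : D.State} {d r d' r' : ℤ} {y : Total D}
    (hy : y ∈ part U α d r) (hd : d = d') (hr : r = r') : y ∈ part U α d' r' := hd ▸ hr ▸ hy

theorem partialDiff_mem {U : Finset (Fin D.n)} {α : D.State} {d r : ℤ} {y : Total D}
    (hy : y ∈ part U α d r) : partialDiff U y ∈ part U α (d - 1) (r + 1) := by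
  rw [partialDiff_apply]
  exact Submodule.sum_mem _ fun m hm => signedMap_mem hm hy

theorem part_erase_le {U : Finset (Fin D.n)} {c : Fin D.n} (hc : c ∈ U) (α : D.State) (b : Bool)
    (d r : ℤ) : part (U.erase c) (Function.update α c b) d r ≤ part U α d r := by
  intro y hy S hS
  obtain ⟨h1, h2, h3⟩ := hy S hS
  refine ⟨fun x hx => ?_, h2, h3⟩
  rw [h1 x (fun h => hx (Finset.mem_of_mem_erase h)),
    Function.update_of_ne (by rintro rfl; exact hx hc)]

theorem apply_of_mem_part_update {U : Finset (Fin D.n)} {c : Fin D.n} (hc : c ∉ U) {α : D.State}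
    {b : Bool} {d r : ℤ} {y : Total D} (hy : y ∈ part U (Function.update α c b) d r)
    {S : D.EnhancedState} (hS : y S ≠ 0) : S.1 c = b := by
  rw [(hy S hS).1 c hc, Function.update_self]

/-- A chain of a cube is the sum of its parts on two opposite faces. -/
theorem exists_face_decomposition {U : Finset (Fin D.n)} {c : Fin D.n} (hc : c ∈ U)
    {α : D.State} {d r : ℤ} {x : Total D} (hx : x ∈ part U α d r) :
    ∃ x0 ∈ part (U.erase c) (Function.update α c false) d r,
      ∃ x1 ∈ part (U.erase c) (Function.update α c true) d r, x = x0 + x1 := by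
  have key : ∀ b, diagOp (fun S => if S.1 c = b then 1 else 0) x ∈
      part (U.erase c) (Function.update α c b) d r := by
    intro b S hS
    rw [diagOp_apply] at hS
    obtain ⟨h1, h2, h3⟩ := hx S (right_ne_zero_of_mul hS)
    have hb : S.1 c = b := by
      by_contra h
      exact hS (by rw [if_neg h, zero_mul])
    refine ⟨fun y hy => ?_, h2, h3⟩
    by_cases hyc : y = c
    · subst hyc; rw [Function.update_self, hb]
    · rw [Function.update_of_ne hyc]
      exact h1 y (fun h => hy (Finset.mem_erase.2 ⟨hyc, h⟩))
  refine ⟨_, key false, _, key true, ?_⟩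
  funext S
  simp only [Pi.add_apply, diagOp_apply]
  cases S.1 c <;> simp

theorem eq_zero_of_face_add {U : Finset (Fin D.n)} {c : Fin D.n} (hc : c ∉ U)
    {α : D.State} {d r : ℤ} {x0 x1 : Total D}
    (h0 : x0 ∈ part U (Function.update α c false) d r)
    (h1 : x1 ∈ part U (Function.update α c true) d r) (h : x0 + x1 = 0) : x0 = 0 ∧ x1 = 0 := by
  have key : x0 = 0 := by
    funext S
    by_contra hS
    have e0 := apply_of_mem_part_update hc h0 hS
    have e1 : x1 S ≠ 0 := by
      intro e
      have := congrFun h S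
      rw [Pi.add_apply, e, add_zero] at this
      exact hS this
    rw [apply_of_mem_part_update hc h1 e1] at e0
    cases e0
  refine ⟨key, ?_⟩
  rwa [key, zero_add] at h

theorem signedMap_eq_zero {U : Finset (Fin D.n)} {c : Fin D.n} (hc : c ∉ U) {α : D.State}
    {b : Bool} {d r : ℤ} {y : Total D} (hy : y ∈ part U (Function.update α c (!b)) d r) :
    signedMap b c y = 0 := by
  funext T
  by_contra h
  obtain ⟨S, hS, hb, -⟩ := ne_zero_of_signedMap h
  rw [apply_of_mem_part_update hc hy hS] at hb
  simp at hb

/-- The complex of the partial resolutions has no homology in the given bidegree. -/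
def ExactAt (U : Finset (Fin D.n)) (α : D.State) (d r : ℤ) : Prop :=
  ∀ x ∈ part U α d r, partialDiff U x = 0 → ∃ y ∈ part U α (d + 1) (r - 1), partialDiff U y = x

/-- The long exact sequence of a crossing. -/
theorem exactAt_of_faces (halt : D.Alternating) {U : Finset (Fin D.n)} {c : Fin D.n} (hc : c ∈ U)
    {α : D.State} {d r : ℤ} (H0 : ExactAt (U.erase c) (Function.update α c false) d r)
    (H1 : ExactAt (U.erase c) (Function.update α c true) d r) : ExactAt U α d r := by
  intro x hx hd
  have hcU : c ∉ U.erase c := Finset.notMem_erase c U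
  obtain ⟨x0, hx0, x1, hx1, rfl⟩ := exists_face_decomposition hc hx
  rw [partialDiff_erase hc, map_add, map_add, signedMap_eq_zero (b := false) hcU hx1, add_zero,
    add_assoc] at hd
  obtain ⟨d0, d1⟩ := eq_zero_of_face_add hcU (partialDiff_mem hx0)
    (add_mem (partialDiff_mem hx1) (signedMap_false_mem hcU hx0)) hd
  obtain ⟨y0, hy0, rfl⟩ := H0 x0 hx0 d0
  have hy0' := mem_part_congr (signedMap_false_mem hcU hy0) (add_sub_cancel_right d 1)
    (sub_add_cancel r 1)
  obtain ⟨y1, hy1, e1⟩ := H1 (x1 - signedMap false c y0) (sub_mem hx1 hy0') (by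
    rw [map_sub, partialDiff_signedMap halt hcU, sub_neg_eq_add, d1])
  refine ⟨y0 + y1, add_mem (part_erase_le hc _ _ _ _ hy0) (part_erase_le hc _ _ _ _ hy1), ?_⟩
  rw [partialDiff_erase hc, map_add, map_add, signedMap_eq_zero (b := false) hcU hy1, e1]
  abel

/-! ### The sign twist on one side of a disconnected resolution -/

/-- A function on the integers with values `±1` that changes its sign under a shift by two. -/
def quarterSign (q : ℤ) : ℚ := if q % 4 = 0 ∨ q % 4 = 1 then 1 else -1

theorem quarterSign_mul_self (q : ℤ) : quarterSign q * quarterSign q = 1 := by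
  unfold quarterSign; split_ifs <;> norm_num

theorem quarterSign_add_two (q : ℤ) : quarterSign (q + 2) = -quarterSign q := by
  unfold quarterSign
  have : ((q + 2) % 4 = 0 ∨ (q + 2) % 4 = 1) ↔ ¬ (q % 4 = 0 ∨ q % 4 = 1) := by omega
  by_cases h : q % 4 = 0 ∨ q % 4 = 1
  · rw [if_pos h, if_neg (fun k => this.1 k h)]
  · rw [if_neg h, if_pos (this.2 h), neg_neg]

theorem quarterSign_sub_two (q : ℤ) : quarterSign (q - 2) = -quarterSign q := by
  have := quarterSign_add_two (q - 2)
  rw [sub_add_cancel] at this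
  rw [this, neg_neg]

open scoped Classical in
/-- The number of `1`-smoothings at the crossings in `W`. -/
noncomputable def onesOn (W : Set D.Pt) (α : D.State) : ℤ :=
  ((Finset.univ.filter fun c => α c = true ∧ D.ptA c ∈ W).card : ℤ)

/-- The quantum degree of the part of an enhanced state inside `W`, up to a constant. -/
noncomputable def qDegOn (W : Set D.Pt) (S : D.EnhancedState) : ℤ := degOn W S + onesOn W S.1

/-- A sign that depends only on the quantum degree inside `W`. When `W` is a union of components,
it commutes with the differential, but it anticommutes with multiplication by `X` on `W`. -/
noncomputable def twist (W : Set D.Pt) : Total D →ₗ[ℚ] Total D :=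
  diagOp fun S => quarterSign (qDegOn W S)

theorem twist_apply (W : Set D.Pt) (y : Total D) (S : D.EnhancedState) :
    twist W y S = quarterSign (qDegOn W S) * y S := rfl

theorem twist_mem {U : Finset (Fin D.n)} {α : D.State} {d r : ℤ} {y : Total D}
    (hy : y ∈ part U α d r) (W : Set D.Pt) : twist W y ∈ part U α d r := diagOp_mem hy _

theorem twist_twist (W : Set D.Pt) (y : Total D) : twist W (twist W y) = y := by
  funext S
  rw [twist_apply, twist_apply, ← mul_assoc, quarterSign_mul_self, one_mul]

theorem onesOn_toggle_of_notMem {W : Set D.Pt} {m : Fin D.n} (h : D.ptA m ∉ W) (α : D.State) :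
    onesOn W (D.toggle m α) = onesOn W α := by
  classical
  unfold onesOn
  congr 2
  refine Finset.filter_congr fun x _ => ?_
  by_cases hx : x = m
  · subst hx; simp [h]
  · rw [toggle_of_ne hx]

theorem onesOn_toggle_of_mem {W : Set D.Pt} {m : Fin D.n} (h : D.ptA m ∈ W) {α : D.State}
    (hα : α m = false) : onesOn W (D.toggle m α) = onesOn W α + 1 := by
  classical
  have : (Finset.univ.filter fun x => D.toggle m α x = true ∧ D.ptA x ∈ W) =
      insert m (Finset.univ.filter fun x => α x = true ∧ D.ptA x ∈ W) := by
    ext x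
    by_cases hx : x = m
    · subst hx; simp [hα, h]
    · simp [toggle_of_ne hx, hx]
  rw [onesOn, onesOn, this, Finset.card_insert_of_notMem (by simp [hα])]
  push_cast; rfl

theorem qDegOn_of_flipCoeff {W : Set D.Pt} {m : Fin D.n} {S T : D.EnhancedState}
    (h : flipCoeff m S T ≠ 0) (hm : S.1 m = false) (hS : Saturated W (D.rel S.1))
    (hT : Saturated W (D.rel T.1)) (hab : D.ptA m ∈ W ↔ D.ptB m ∈ W) :
    qDegOn W T = qDegOn W S := by
  classical
  obtain ⟨h1, h2, -⟩ := flipCoeff_ne_zero h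
  have h3 := degOn_sub_degOn h1 h2 hS hT hab
  have h4 := locDeg_of_flipCoeff h
  unfold qDegOn
  rw [h1]
  by_cases hA : D.ptA m ∈ W
  · rw [if_pos hA] at h3
    rw [onesOn_toggle_of_mem hA hm]
    linarith
  · rw [if_neg hA] at h3
    rw [onesOn_toggle_of_notMem hA]
    linarith

theorem signedMap_twist {W : Set D.Pt} {m : Fin D.n} {y : Total D}
    (hy : ∀ S, y S ≠ 0 → Saturated W (D.rel S.1) ∧ Saturated W (D.rel (D.toggle m S.1)))
    (hab : D.ptA m ∈ W ↔ D.ptB m ∈ W) :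
    signedMap false m (twist W y) = twist W (signedMap false m y) := by
  funext T
  rw [twist_apply, signedMap_eq, signedMap_eq, edgeMap_apply, edgeMap_apply, Finset.mul_sum]
  refine Finset.sum_congr rfl fun S _ => ?_
  rw [diagOp_apply, diagOp_apply, twist_apply]
  by_cases hf : flipCoeff m S T = 0
  · rw [hf]; ring
  by_cases hS : y S = 0
  · rw [hS]; ring
  by_cases hm : S.1 m = false
  · rw [qDegOn_of_flipCoeff hf hm (hy S hS).1 ((flipCoeff_ne_zero hf).1 ▸ (hy S hS).2) hab]
    ring
  · rw [faceSign, if_neg hm]; ring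

theorem qDegOn_flipAt_of_notMem {W : Set D.Pt} {S : D.EnhancedState}
    (hW : Saturated W (D.rel S.1)) {p : D.Pt} (hp : p ∉ W) :
    qDegOn W (flipAt p S) = qDegOn W S := by
  classical
  rw [qDegOn, degOn_flipAt hW, if_neg hp, sub_zero]; rfl

theorem quarterSign_flipAt {W : Set D.Pt} {S : D.EnhancedState}
    (hW : Saturated W (D.rel S.1)) {p : D.Pt} (hp : p ∈ W) :
    quarterSign (qDegOn W (flipAt p S)) = -quarterSign (qDegOn W S) := by
  classical
  rw [qDegOn, degOn_flipAt hW, if_pos hp, flipAt_fst]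
  cases lab S p
  · rw [show degOn W S - 2 * labDeg false + onesOn W S.1 = qDegOn W S + 2 by
      rw [qDegOn, labDeg]; simp; ring]
    exact quarterSign_add_two _
  · rw [show degOn W S - 2 * labDeg true + onesOn W S.1 = qDegOn W S - 2 by
      rw [qDegOn, labDeg]; simp; ring]
    exact quarterSign_sub_two _

theorem twist_mulX_of_notMem {W : Set D.Pt} {y : Total D}
    (hy : ∀ S, y S ≠ 0 → Saturated W (D.rel S.1)) {p : D.Pt} (hp : p ∉ W) :
    twist W (mulX p y) = mulX p (twist W y) := by
  funext T
  rw [twist_apply, mulX_apply, mulX_apply, twist_apply]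
  by_cases h : y (flipAt p T) = 0
  · simp [h]
  · rw [qDegOn_flipAt_of_notMem (S := T) (hy (flipAt p T) h) hp]
    split_ifs <;> simp

theorem twist_mulX_of_mem {W : Set D.Pt} {y : Total D}
    (hy : ∀ S, y S ≠ 0 → Saturated W (D.rel S.1)) {p : D.Pt} (hp : p ∈ W) :
    twist W (mulX p y) = -mulX p (twist W y) := by
  funext T
  rw [Pi.neg_apply, twist_apply, mulX_apply, mulX_apply, twist_apply]
  by_cases h : y (flipAt p T) = 0
  · simp [h]
  · rw [quarterSign_flipAt (S := T) (hy (flipAt p T) h) hp]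
    split_ifs <;> simp

theorem twist_delX_of_mem {W : Set D.Pt} {y : Total D}
    (hy : ∀ S, y S ≠ 0 → Saturated W (D.rel S.1)) {p : D.Pt} (hp : p ∈ W) :
    twist W (delX p y) = -delX p (twist W y) := by
  funext T
  rw [Pi.neg_apply, twist_apply, delX_apply, delX_apply, twist_apply]
  by_cases h : y (flipAt p T) = 0
  · simp [h]
  · rw [quarterSign_flipAt (S := T) (hy (flipAt p T) h) hp]
    split_ifs <;> simp

theorem delX_mulX_comm {y : Total D} {p q : D.Pt} (hy : ∀ S, y S ≠ 0 → ¬ D.rel S.1 p q) :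
    delX p (mulX q y) = mulX q (delX p y) := by
  funext T
  simp only [mulX_apply, delX_apply]
  rw [flipAt_comm]
  by_cases h : y (flipAt p (flipAt q T)) = 0
  · simp [h]
  · have h1 : ¬ D.rel T.1 p q := hy (flipAt p (flipAt q T)) h
    have h2 : ¬ D.rel T.1 q p := fun k => h1 (Setoid.symm' _ k)
    rw [lab_flipAt_of_not h1, lab_flipAt_of_not h2]
    split_ifs <;> rfl

/-! ### A crossing with a disconnected resolution -/

/-- The two resolved strands at `c` are in different components of the diagrams of the states `A`,
and `W` is the set of points of the component of the second strand. Then `edgeMap c` is the product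
`V ⊗ V → V` on the states `A` and the coproduct `V → V ⊗ V` on the states with the other smoothing
at `c`, for the tensor factors of `ptA c` and `ptB c`. With `twist W` in between, the two maps form
a short exact sequence, which the next lemmas express by explicit homotopies. -/
structure Separates (W : Set D.Pt) (c : Fin D.n) (A : Set D.State) : Prop where
  sat : ∀ α ∈ A, Saturated W (D.rel α)
  notMem : D.ptA c ∉ W
  mem : D.ptB c ∈ W

theorem Separates.not_rel {W : Set D.Pt} {c : Fin D.n} {A : Set D.State} (h : Separates W c A)
    {α : D.State} (hα : α ∈ A) : ¬ D.rel α (D.ptA c) (D.ptB c) :=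
  fun k => h.notMem ((h.sat α hα _ _ k).2 h.mem)

theorem Separates.rel_toggle (halt : D.Alternating) {W : Set D.Pt} {c : Fin D.n}
    {A : Set D.State} (h : Separates W c A) {α : D.State} (hα : D.toggle c α ∈ A) :
    D.rel α (D.ptA c) (D.ptB c) := (LinkDiagram.rel_toggle halt α c).2 (h.not_rel hα)

/-- The coproduct after the product is multiplication by `X ⊗ 1 + 1 ⊗ X`. -/
theorem edgeMap_edgeMap (halt : D.Alternating) {W : Set D.Pt} {c : Fin D.n} {A : Set D.State}
    (h : Separates W c A) {y : Total D} (hy : ∀ S, y S ≠ 0 → S.1 ∈ A) :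
    edgeMap c (edgeMap c y) = mulX (D.ptA c) y + mulX (D.ptB c) y := by
  refine map_eq_of_basis (F := edgeMap c ∘ₗ edgeMap c) (G := mulX (D.ptA c) + mulX (D.ptB c))
    fun S hS => ?_
  refine label_induction Set.univ
    (motive := fun S => (edgeMap c ∘ₗ edgeMap c) (basis S) =
      (mulX (D.ptA c) + mulX (D.ptB c)) (basis S)) (fun T hT hl => ?_)
    (fun T p _ _ hp ih => ?_) S rfl
  · rw [eq_unitState_iff.2 ⟨rfl, fun p => hl p trivial⟩, LinearMap.comp_apply,
      edgeMap_unit_of_not halt (hT ▸ h.not_rel (hy S hS)), edgeMap_unit_of_rel halt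
      (rel_toggle_of_not halt (hT ▸ h.not_rel (hy S hS))), toggle_toggle]
    rfl
  · rw [← mulX_basis hp]
    simp only [LinearMap.comp_apply, LinearMap.add_apply, edgeMap_mulX halt] at ih ⊢
    rw [ih, map_add, mulX_comm p, mulX_comm p]

/-- Every element of `V ⊗ V` that the twisted product kills is a coproduct. -/
theorem twist_homotopy (halt : D.Alternating) {W : Set D.Pt} {c : Fin D.n} {A : Set D.State}
    (h : Separates W c A) {y : Total D} (hy : ∀ S, y S ≠ 0 → S.1 ∈ A) :
    edgeMap c (edgeMap c (delX (D.ptB c) y)) +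
      twist W (delX (D.ptB c) (edgeMap c (edgeMap c (twist W y)))) = y := by
  have hy1 : ∀ S, delX (D.ptB c) y S ≠ 0 → S.1 ∈ A := fun S hS => by
    rw [delX_apply] at hS
    split_ifs at hS
    · exact hy (flipAt (D.ptB c) S) hS
    · exact absurd rfl hS
  have hy2 : ∀ S, twist W y S ≠ 0 → S.1 ∈ A := fun S hS => hy S (right_ne_zero_of_mul hS)
  rw [edgeMap_edgeMap halt h hy1, edgeMap_edgeMap halt h hy2]
  have hsat : ∀ {z : Total D}, (∀ S, z S ≠ 0 → S.1 ∈ A) →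
      ∀ S, z S ≠ 0 → Saturated W (D.rel S.1) := fun hz S hS => h.sat _ (hz S hS)
  have hmul : ∀ {z : Total D} (p : D.Pt), (∀ S, z S ≠ 0 → S.1 ∈ A) →
      ∀ S, mulX p z S ≠ 0 → S.1 ∈ A := fun p hz S hS => by
    rw [mulX_apply] at hS
    split_ifs at hS
    · exact hz (flipAt p S) hS
    · exact absurd rfl hS
  have hA := twist_mulX_of_notMem (hsat hy) h.notMem
  have hB := twist_mulX_of_mem (hsat hy) h.mem
  rw [← hA, ← neg_eq_iff_eq_neg.2 hB, ← map_neg, ← map_add, ← sub_eq_add_neg]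
  have hz : ∀ S, (mulX (D.ptA c) y - mulX (D.ptB c) y) S ≠ 0 → S.1 ∈ A := fun S hS => by
    by_contra k
    have e1 : mulX (D.ptA c) y S = 0 := by_contra fun e => k (hmul _ hy S e)
    have e2 : mulX (D.ptB c) y S = 0 := by_contra fun e => k (hmul _ hy S e)
    rw [Pi.sub_apply, e1, e2, sub_zero] at hS
    exact hS rfl
  rw [← neg_eq_iff_eq_neg.2 (twist_delX_of_mem (hsat hz) h.mem), map_neg, twist_twist, map_sub,
    delX_mulX_comm fun S hS k => h.not_rel (hy S hS) (Setoid.symm' _ k)]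
  conv_rhs => rw [← delX_mulX_add (D.ptB c) y]
  abel

theorem ne_zero_edgeMap_mem {c : Fin D.n} {A : Set D.State} {y : Total D}
    (hy : ∀ S, y S ≠ 0 → D.toggle c S.1 ∈ A) : ∀ S, edgeMap c y S ≠ 0 → S.1 ∈ A := by
  intro T hT
  obtain ⟨S, hS, hf⟩ := ne_zero_of_edgeMap hT
  rw [(flipCoeff_ne_zero hf).1]
  exact hy S hS

theorem ne_zero_basis {S T : D.EnhancedState} (h : basis S T ≠ 0) : T = S := by
  classical
  by_contra k
  rw [basis_apply, if_neg k] at h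
  exact h rfl

/-- The coproduct has a left inverse, and the product has a right inverse. -/
theorem edgeMap_delX_edgeMap (halt : D.Alternating) {W : Set D.Pt} {c : Fin D.n}
    {A : Set D.State} (h : Separates W c A) {y : Total D}
    (hy : ∀ S, y S ≠ 0 → D.toggle c S.1 ∈ A) :
    edgeMap c (delX (D.ptB c) (edgeMap c y)) = y := by
  refine map_eq_of_basis (F := edgeMap c ∘ₗ delX (D.ptB c) ∘ₗ edgeMap c) (G := LinearMap.id)
    fun S hS => ?_
  have hmem := hy S hS
  generalize hα : S.1 = α at hmem
  have hr := h.rel_toggle halt hmem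
  -- Every cycle of the merged state meets a cycle other than that of `ptB c` before the merger.
  refine label_induction {p | ¬ D.rel (D.toggle c α) (D.ptB c) p}
    (motive := fun S => (edgeMap c ∘ₗ delX (D.ptB c) ∘ₗ edgeMap c) (basis S) =
      LinearMap.id (basis S)) (fun T hT hl => ?_) (fun T p hT hpQ hp ih => ?_) S hα
  · have hl' : ∀ p, lab T p = true := by
      have hA := hl (D.ptA c) fun k => h.not_rel hmem (Setoid.symm' _ k)
      intro p
      by_cases hp : D.rel (D.toggle c α) (D.ptB c) p
      · have hBA : D.rel (D.toggle c α) ≤ D.rel α := by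
          have := rel_toggle_eq_glue halt (h.not_rel hmem)
          rw [toggle_toggle] at this
          rw [this]; exact Setoid.le_glue _ _ _
        have : D.rel T.1 (D.ptA c) p := by
          rw [hT]; exact Setoid.trans' _ hr (hBA hp)
        rw [← lab_congr this, hA]
      · exact hl p hp
    rw [eq_unitState_iff.2 ⟨hT, hl'⟩]
    simp only [LinearMap.comp_apply, LinearMap.id_apply]
    rw [edgeMap_unit_of_rel halt hr, map_add, mulX_basis rfl, mulX_basis rfl,
      delX_basis_of_true, delX_basis, flipAt_flipAt, zero_add,
      edgeMap_unit_of_not halt (h.not_rel hmem), toggle_toggle]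
    · rw [lab_flipAt_self]; rfl
    · exact lab_flipAt_of_not (S := unitState (D.toggle c α))
        fun k => h.not_rel hmem (Setoid.symm' _ k)
  · rw [← mulX_basis hp]
    simp only [LinearMap.comp_apply, LinearMap.id_apply, edgeMap_mulX halt] at ih ⊢
    rw [delX_mulX_comm, edgeMap_mulX halt, ih]
    intro R hR
    have := ne_zero_edgeMap_mem (A := {D.toggle c α}) (c := c) (y := basis T) (fun S hS => by
      rw [ne_zero_basis hS, hT]; rfl) R hR
    rw [Set.mem_singleton_iff.1 this]
    exact hpQ

/-- The twisted product kills all coproducts. -/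
theorem edgeMap_twist_edgeMap (halt : D.Alternating) {W : Set D.Pt} {c : Fin D.n}
    {A : Set D.State} (h : Separates W c A) {y : Total D}
    (hy : ∀ S, y S ≠ 0 → D.toggle c S.1 ∈ A) :
    edgeMap c (twist W (edgeMap c y)) = 0 := by
  refine map_eq_of_basis (F := edgeMap c ∘ₗ twist W ∘ₗ edgeMap c) (G := 0) fun S hS => ?_
  have hmem := hy S hS
  generalize hα : S.1 = α at hmem
  have hr := h.rel_toggle halt hmem
  refine label_induction Set.univ
    (motive := fun S => (edgeMap c ∘ₗ twist W ∘ₗ edgeMap c) (basis S) =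
      (0 : Total D →ₗ[ℚ] Total D) (basis S)) (fun T hT hl => ?_) (fun T p hT _ hp ih => ?_) S hα
  · rw [eq_unitState_iff.2 ⟨hT, fun p => hl p trivial⟩]
    simp only [LinearMap.comp_apply, LinearMap.zero_apply]
    have hu : ∀ S, basis (unitState (D.toggle c α)) S ≠ 0 → Saturated W (D.rel S.1) :=
      fun S hS => by rw [ne_zero_basis hS]; exact h.sat _ hmem
    rw [edgeMap_unit_of_rel halt hr, map_add, twist_mulX_of_notMem hu h.notMem,
      twist_mulX_of_mem hu h.mem, twist, diagOp_basis]
    simp only [map_add, map_neg, map_smul, edgeMap_mulX halt]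
    rw [edgeMap_unit_of_not halt (h.not_rel hmem), toggle_toggle,
      mulX_basis_congr (S := unitState α) hr, add_neg_cancel]
  · rw [← mulX_basis hp]
    simp only [LinearMap.comp_apply, LinearMap.zero_apply, edgeMap_mulX halt] at ih ⊢
    have hu : ∀ S, edgeMap c (basis T) S ≠ 0 → Saturated W (D.rel S.1) := fun R hR =>
      h.sat _ (ne_zero_edgeMap_mem (A := A) (c := c) (y := basis T) (fun S hS => by
        rw [ne_zero_basis hS, hT]; exact hmem) R hR)
    by_cases hpW : p ∈ W
    · rw [twist_mulX_of_mem hu hpW, map_neg, edgeMap_mulX halt, ih, map_zero, neg_zero]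
    · rw [twist_mulX_of_notMem hu hpW, edgeMap_mulX halt, ih, map_zero]

/-! ### The signed version of the short exact sequence -/

/-- The sign of the edges in the direction `c`, as an operator. -/
noncomputable def signOp (c : Fin D.n) : Total D →ₗ[ℚ] Total D := diagOp fun S => cubeSign c S.1

theorem signOp_signOp (c : Fin D.n) (y : Total D) : signOp c (signOp c y) = y := by
  funext S
  simp only [signOp, diagOp_apply]
  rw [← mul_assoc, cubeSign_mul_self, one_mul]

theorem signOp_edgeMap (c : Fin D.n) (y : Total D) :
    signOp c (edgeMap c y) = edgeMap c (signOp c y) := by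
  rw [signOp, diagOp_edgeMap]
  simp only [cubeSign_toggle_of_not_lt (lt_irrefl c)]

theorem signOp_delX (c : Fin D.n) (p : D.Pt) (y : Total D) :
    signOp c (delX p y) = delX p (signOp c y) := by
  funext S
  simp only [signOp, diagOp_apply, delX_apply]
  split_ifs <;> simp

theorem signOp_twist (c : Fin D.n) (W : Set D.Pt) (y : Total D) :
    signOp c (twist W y) = twist W (signOp c y) := diagOp_comm _ _ _

theorem signedMap_eq_edgeMap_signOp {b : Bool} {c : Fin D.n} {y : Total D}
    (hy : ∀ S, y S ≠ 0 → S.1 c = b) : signedMap b c y = edgeMap c (signOp c y) := by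
  rw [signedMap_eq]
  congr 1
  funext S
  rw [signOp, diagOp_apply, diagOp_apply, faceSign]
  by_cases hS : y S = 0
  · rw [hS]; ring
  · rw [if_pos (hy S hS)]

section

variable {W : Set D.Pt} {U : Finset (Fin D.n)} {c : Fin D.n} {α : D.State} {b : Bool} {d r : ℤ}
  {y : Total D}

theorem toggle_mem_of_part (hc : c ∉ U) (hy : y ∈ part U (Function.update α c (!b)) d r)
    (S : D.EnhancedState) (hS : y S ≠ 0) :
    D.toggle c S.1 ∈ {β : D.State | ∀ x ∉ U, β x = Function.update α c b x} := by
  intro x hx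
  by_cases hxc : x = c
  · subst hxc
    rw [toggle_self, apply_of_mem_part_update hc hy hS]; simp
  · rw [toggle_of_ne hxc, (hy S hS).1 x hx]; simp [hxc]

theorem signedMap_delX_signedMap (halt : D.Alternating) (hc : c ∉ U)
    (h : Separates W c {β | ∀ x ∉ U, β x = Function.update α c b x})
    (hy : y ∈ part U (Function.update α c (!b)) d r) :
    signedMap b c (delX (D.ptB c) (signedMap (!b) c y)) = y := by
  have h1 := delX_mem (signedMap_mem_update hc hy) (D.ptB c)
  rw [Bool.not_not] at h1
  rw [signedMap_eq_edgeMap_signOp fun S hS => apply_of_mem_part_update hc h1 hS,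
    signedMap_eq_edgeMap_signOp fun S hS => apply_of_mem_part_update hc hy hS, signOp_delX,
    signOp_edgeMap, signOp_signOp,
    edgeMap_delX_edgeMap halt h fun S hS => toggle_mem_of_part hc hy S hS]

theorem signedMap_twist_signedMap (halt : D.Alternating) (hc : c ∉ U)
    (h : Separates W c {β | ∀ x ∉ U, β x = Function.update α c b x})
    (hy : y ∈ part U (Function.update α c (!b)) d r) :
    signedMap b c (twist W (signedMap (!b) c y)) = 0 := by
  have h1 := twist_mem (signedMap_mem_update hc hy) W
  rw [Bool.not_not] at h1
  rw [signedMap_eq_edgeMap_signOp fun S hS => apply_of_mem_part_update hc h1 hS,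
    signedMap_eq_edgeMap_signOp fun S hS => apply_of_mem_part_update hc hy hS, signOp_twist,
    signOp_edgeMap, signOp_signOp,
    edgeMap_twist_edgeMap halt h fun S hS => toggle_mem_of_part hc hy S hS]

theorem signedMap_homotopy (halt : D.Alternating) (hc : c ∉ U)
    (h : Separates W c {β | ∀ x ∉ U, β x = Function.update α c b x})
    (hy : y ∈ part U (Function.update α c b) d r) :
    signedMap (!b) c (signedMap b c (delX (D.ptB c) y)) +
      twist W (delX (D.ptB c) (signedMap (!b) c (signedMap b c (twist W y)))) = y := by
  have key : ∀ {z : Total D} {d r : ℤ}, z ∈ part U (Function.update α c b) d r →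
      signedMap (!b) c (signedMap b c z) = edgeMap c (edgeMap c z) := by
    intro z d r hz
    rw [signedMap_eq_edgeMap_signOp fun S hS =>
        apply_of_mem_part_update hc (signedMap_mem_update hc hz) hS,
      signedMap_eq_edgeMap_signOp fun S hS => apply_of_mem_part_update hc hz hS, signOp_edgeMap,
      signOp_signOp]
  rw [key (delX_mem hy _), key (twist_mem hy W)]
  exact twist_homotopy halt h fun S hS => (hy S hS).1

theorem partialDiff_twist (hW : ∀ β : D.State, (∀ x ∉ U, β x = α x) → Saturated W (D.rel β))
    (hU : ∀ m ∈ U, D.ptA m ∈ W ↔ D.ptB m ∈ W) (hy : y ∈ part U α d r) :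
    partialDiff U (twist W y) = twist W (partialDiff U y) := by
  rw [partialDiff_apply, partialDiff_apply, map_sum]
  refine Finset.sum_congr rfl fun m hm => signedMap_twist (fun S hS => ?_) (hU m hm)
  have := (hy S hS).1
  refine ⟨hW _ this, hW _ fun x hx => ?_⟩
  rw [toggle_of_ne (by rintro rfl; exact hx hm), this x hx]

end

/-- The component of a disconnected resolution that contains the second strand at the crossing. -/
theorem exists_separates {U : Finset (Fin D.n)} {c : Fin D.n} {α : D.State}
    (h : ¬ compRel U α (D.ptA c) (D.ptB c)) :
    ∃ W : Set D.Pt, Separates W c {β | ∀ x ∉ U, β x = α x} ∧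
      ∀ m ∈ U, D.ptA m ∈ W ↔ D.ptB m ∈ W := by
  have sat : Saturated {p | compRel U α p (D.ptB c)} (compRel U α) := fun p q k =>
    ⟨fun hp => Setoid.trans' _ (Setoid.symm' _ k) hp, fun hq => Setoid.trans' _ k hq⟩
  exact ⟨{p | compRel U α p (D.ptB c)},
    ⟨fun β hβ => sat.mono (compRel_erase_rel hβ), h, Setoid.refl' (compRel U α) _⟩,
    fun m hm => sat _ _ (compRel_pair α hm)⟩

/-- If the `0`-smoothing at `c` is disconnected, the homology is that of the `1`-smoothing. -/
theorem exactAt_of_not_compRel_false (halt : D.Alternating) {U : Finset (Fin D.n)} {c : Fin D.n}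
    (hc : c ∈ U) {α : D.State}
    (h : ¬ compRel (U.erase c) (Function.update α c false) (D.ptA c) (D.ptB c)) {d r : ℤ}
    (H : ExactAt (U.erase c) (Function.update α c true) (d + 1) (r + 1)) : ExactAt U α d r := by
  obtain ⟨W, hW, hWU⟩ := exists_separates h
  have hcU : c ∉ U.erase c := Finset.notMem_erase c U
  intro x hx hd
  obtain ⟨x0, hx0, x1, hx1, rfl⟩ := exists_face_decomposition hc hx
  rw [partialDiff_erase hc, map_add, map_add, signedMap_eq_zero (b := false) hcU hx1, add_zero,
    add_assoc] at hd
  obtain ⟨d0, d1⟩ := eq_zero_of_face_add hcU (partialDiff_mem hx0)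
    (add_mem (partialDiff_mem hx1) (signedMap_false_mem hcU hx0)) hd
  set w := delX (D.ptB c) (signedMap true c x1) with hw
  have hw' : w ∈ part (U.erase c) (Function.update α c false) (d + 1) (r - 1) :=
    mem_part_congr (delX_mem (signedMap_true_mem hcU hx1) (D.ptB c)) (by ring) (by ring)
  have hMw : signedMap false c w = x1 := signedMap_delX_signedMap (b := false) halt hcU hW hx1
  set x' := x0 - partialDiff (U.erase c) w with hx'
  have hx'm : x' ∈ part (U.erase c) (Function.update α c false) d r := by
    have := partialDiff_mem hw'
    rw [add_sub_cancel_right, sub_add_cancel] at this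
    exact sub_mem hx0 this
  have hdx' : partialDiff (U.erase c) x' = 0 := by
    rw [hx', map_sub, d0, partialDiff_partialDiff halt, sub_zero]
  have hMx' : signedMap false c x' = 0 := by
    have := partialDiff_signedMap halt hcU false w
    rw [hMw] at this
    rw [hx', map_sub, eq_sub_of_add_eq' d1, this]
    abel
  set v := signedMap false c (delX (D.ptB c) (twist W x')) with hv
  have hτx' : twist W x' ∈ part (U.erase c) (Function.update α c false) d r := twist_mem hx'm W
  have hvm : v ∈ part (U.erase c) (Function.update α c true) (d + 1) (r + 1) :=
    mem_part_congr (signedMap_false_mem hcU (delX_mem hτx' (D.ptB c))) (by ring) (by ring)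
  have hSv : signedMap true c v = twist W x' := by
    have := signedMap_homotopy (b := false) halt hcU hW hτx'
    rw [twist_twist, hMx', map_zero, map_zero, map_zero, add_zero] at this
    exact this
  have hdv : partialDiff (U.erase c) v = 0 := by
    have h1 : signedMap true c (partialDiff (U.erase c) v) = 0 := by
      rw [← neg_eq_zero, ← partialDiff_signedMap halt hcU, hSv,
        partialDiff_twist hW.sat hWU hx'm, hdx', map_zero]
    have := signedMap_delX_signedMap (b := false) halt hcU hW (partialDiff_mem hvm)
    rw [Bool.not_false, h1, map_zero, map_zero] at this
    exact this.symm
  obtain ⟨u, hu, hdu⟩ := H v hvm hdv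
  have hSu := signedMap_true_mem hcU hu
  have hy' : twist W (signedMap true c u) ∈
      part (U.erase c) (Function.update α c false) (d + 1) (r - 1) :=
    mem_part_congr (twist_mem hSu W) (by ring) (by ring)
  refine ⟨w - twist W (signedMap true c u),
    part_erase_le hc _ _ _ _ (sub_mem hw' hy'), ?_⟩
  have hMy : signedMap false c (twist W (signedMap true c u)) = 0 :=
    signedMap_twist_signedMap (b := false) halt hcU hW hu
  have hdy : partialDiff (U.erase c) (twist W (signedMap true c u)) = -x' := by
    rw [partialDiff_twist hW.sat hWU hSu, partialDiff_signedMap halt hcU, hdu, hSv, map_neg,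
      twist_twist]
  rw [partialDiff_erase hc, map_sub, map_sub, hMw, hMy, hdy, hx']
  abel

/-- If the `1`-smoothing at `c` is disconnected, the homology is that of the `0`-smoothing. -/
theorem exactAt_of_not_compRel_true (halt : D.Alternating) {U : Finset (Fin D.n)} {c : Fin D.n}
    (hc : c ∈ U) {α : D.State}
    (h : ¬ compRel (U.erase c) (Function.update α c true) (D.ptA c) (D.ptB c)) {d r : ℤ}
    (H : ExactAt (U.erase c) (Function.update α c false) (d - 1) (r - 1)) : ExactAt U α d r := by
  obtain ⟨W, hW, hWU⟩ := exists_separates h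
  have hcU : c ∉ U.erase c := Finset.notMem_erase c U
  intro x hx hd
  obtain ⟨x0, hx0, x1, hx1, rfl⟩ := exists_face_decomposition hc hx
  rw [partialDiff_erase hc, map_add, map_add, signedMap_eq_zero (b := false) hcU hx1, add_zero,
    add_assoc] at hd
  obtain ⟨d0, d1⟩ := eq_zero_of_face_add hcU (partialDiff_mem hx0)
    (add_mem (partialDiff_mem hx1) (signedMap_false_mem hcU hx0)) hd
  have hτx1 : twist W x1 ∈ part (U.erase c) (Function.update α c true) d r := twist_mem hx1 W
  have hz : signedMap true c (twist W x1) ∈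
      part (U.erase c) (Function.update α c false) (d - 1) (r - 1) :=
    signedMap_true_mem hcU hτx1
  have hdz : partialDiff (U.erase c) (signedMap true c (twist W x1)) = 0 := by
    rw [partialDiff_signedMap halt hcU, partialDiff_twist hW.sat hWU hx1,
      eq_neg_of_add_eq_zero_left d1, map_neg, map_neg, neg_neg]
    exact signedMap_twist_signedMap (b := true) halt hcU hW hx0
  obtain ⟨u, hu, hdu⟩ := H _ hz hdz
  set w := twist W (delX (D.ptB c) (signedMap false c u)) with hw
  have hw' : w ∈ part (U.erase c) (Function.update α c true) (d + 1) (r - 1) :=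
    mem_part_congr (twist_mem (delX_mem (signedMap_false_mem hcU hu) (D.ptB c)) W)
      (by ring) (by ring)
  have hMw : signedMap true c (twist W w) = u := by
    rw [hw, twist_twist]
    exact signedMap_delX_signedMap (b := true) halt hcU hW hu
  set t := x1 + partialDiff (U.erase c) w with ht
  have htm : t ∈ part (U.erase c) (Function.update α c true) d r := by
    have := partialDiff_mem hw'
    rw [add_sub_cancel_right, sub_add_cancel] at this
    exact add_mem hx1 this
  have hMt : signedMap true c (twist W t) = 0 := by
    rw [ht, map_add, map_add, ← partialDiff_twist hW.sat hWU hw',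
      ← neg_eq_iff_eq_neg.2 (partialDiff_signedMap halt hcU true (twist W w)), hMw, hdu,
      add_neg_cancel]
  set v := signedMap true c (delX (D.ptB c) t) with hv
  have hvm : v ∈ part (U.erase c) (Function.update α c false) (d + 1) (r - 1) :=
    mem_part_congr (signedMap_true_mem hcU (delX_mem htm (D.ptB c))) (by ring) (by ring)
  have hSv : signedMap false c v = t := by
    have := signedMap_homotopy (b := true) halt hcU hW htm
    rw [hMt, map_zero, map_zero, map_zero, add_zero] at this
    exact this
  have hdv : partialDiff (U.erase c) v = x0 := by
    have h1 : signedMap false c (x0 - partialDiff (U.erase c) v) = 0 := by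
      rw [map_sub, ← neg_eq_iff_eq_neg.2 (partialDiff_signedMap halt hcU false v), hSv, ht,
        map_add, partialDiff_partialDiff halt, add_zero, sub_neg_eq_add, add_comm, d1]
    have hm : x0 - partialDiff (U.erase c) v ∈
        part (U.erase c) (Function.update α c false) d r := by
      have := partialDiff_mem hvm
      rw [add_sub_cancel_right, sub_add_cancel] at this
      exact sub_mem hx0 this
    have := signedMap_delX_signedMap (b := true) halt hcU hW hm
    rw [Bool.not_true, h1, map_zero, map_zero] at this
    exact (sub_eq_zero.1 this.symm).symm
  refine ⟨v - w, sub_mem (part_erase_le hc _ _ _ _ hvm) (part_erase_le hc _ _ _ _ hw'), ?_⟩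
  rw [partialDiff_erase hc, map_sub, map_sub, hdv, hSv,
    signedMap_eq_zero (b := false) hcU hw', ht]
  abel

/-! ### Thinness -/

theorem deg_of_cycleCount_eq_one {S : D.EnhancedState} (h : cycleCount S.1 = 1) :
    deg S = 1 ∨ deg S = -1 := by
  obtain ⟨z, hz⟩ := Fintype.card_eq_one_iff.1 h
  have : deg S = labDeg (S.2 z) := by
    refine (Fintype.sum_eq_single z fun w hw => absurd (hz w) hw)
  rw [this]
  cases S.2 z
  · right; rfl
  · left; rfl

/-- A connected partial resolution whose surface is a sphere has homology on two diagonals only: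
if both smoothings of a crossing are connected, this follows from its long exact sequence,
otherwise one of the smoothings has the same homology. -/
theorem exactAt_of_connected (halt : D.Alternating) (U : Finset (Fin D.n)) (α : D.State)
    (hconn : Nat.card (Quotient (compRel U α)) = 1)
    (hk : cycleCount (fill U false α) + cycleCount (fill U true α) = U.card + 2) {d r : ℤ}
    (h1 : d - r ≠ -cycleCount (fill U false α) - ones (fill U false α))
    (h2 : d - r ≠ 2 - cycleCount (fill U false α) - ones (fill U false α)) :
    ExactAt U α d r := by
  induction hn : U.card generalizing U α d r with
  | zero =>
    obtain rfl := Finset.card_eq_zero.1 hn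
    have hf : fill ∅ false α = α := by funext c; simp [fill]
    rw [hf] at h1 h2
    rw [compRel_empty, ← cycleCount_eq] at hconn
    rw [hconn] at h1 h2
    intro x hx _
    refine ⟨0, zero_mem _, ?_⟩
    rw [map_zero]
    funext S
    by_contra hS
    obtain ⟨e1, e2, e3⟩ := hx S (fun e => hS e.symm)
    have e1 : S.1 = α := funext fun c => e1 c (by simp)
    rw [e1] at e3
    rcases deg_of_cycleCount_eq_one (S := S) (e1 ▸ hconn) with h | h <;>
      push_cast at h1 h2 <;> omega
  | succ k ih =>
    obtain ⟨c, hc⟩ : U.Nonempty := Finset.card_pos.1 (by omega)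
    have hcard : (U.erase c).card = k := by rw [Finset.card_erase_of_mem hc, hn]; rfl
    have f0 := fill_erase_update hc false α
    have f1 := fill_erase_update hc true α
    have g0 := fill_erase_update_not hc false α
    have g1 := fill_erase_update_not hc true α
    rw [Bool.not_false] at g0
    rw [Bool.not_true] at g1
    have hones := ones_toggle c (fill U false α)
    rw [show fill U false α c = false by simp [fill, hc]] at hones
    simp only [Bool.false_eq_true, if_false] at hones
    have hcomp : ∀ b, compRel (U.erase c) (Function.update α c b) (D.ptA c) (D.ptB c) →
        Nat.card (Quotient (compRel (U.erase c) (Function.update α c b))) = 1 := fun b hb => by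
      have := compRel_glue (Function.update α c b) hc
      rw [Setoid.glue_eq_self hb, compRel_update α hc] at this
      rwa [this]
    have t0 := fun h => cycleCount_toggle_of_rel halt (α := fill U false α) (m := c) h
    have t0' := fun h => cycleCount_toggle_of_not halt (α := fill U false α) (m := c) h
    have t1 := fun h => cycleCount_toggle_of_rel halt (α := fill U true α) (m := c) h
    have t1' := fun h => cycleCount_toggle_of_not halt (α := fill U true α) (m := c) h
    have agree : ∀ (b b' : Bool), D.rel (fill (U.erase c) b' (Function.update α c b)) ≤
        compRel (U.erase c) (Function.update α c b) := fun b b' =>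
      compRel_erase_rel fun x hx => by simp [fill, hx]
    by_cases h0 : compRel (U.erase c) (Function.update α c false) (D.ptA c) (D.ptB c)
    · by_cases h0' : compRel (U.erase c) (Function.update α c true) (D.ptA c) (D.ptB c)
      · have e0 := cycleCount_add_le halt (U.erase c) (Function.update α c false)
        have e1 := cycleCount_add_le halt (U.erase c) (Function.update α c true)
        rw [hcomp _ h0, f0, g1, hcard] at e0
        rw [hcomp _ h0', f1, g0, hcard] at e1
        have k1 : cycleCount (D.toggle c (fill U true α)) + 1 = cycleCount (fill U true α) := by
          by_cases h : D.rel (fill U true α) (D.ptA c) (D.ptB c)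
          · have := t1 h; omega
          · exact t1' h
        have k0 : cycleCount (D.toggle c (fill U false α)) + 1 = cycleCount (fill U false α) := by
          by_cases h : D.rel (fill U false α) (D.ptA c) (D.ptB c)
          · have := t0 h; omega
          · exact t0' h
        refine exactAt_of_faces halt hc (ih _ _ (hcomp _ h0) ?_ ?_ ?_ hcard)
          (ih _ _ (hcomp _ h0') ?_ ?_ ?_ hcard)
        · rw [f0, g1, hcard]; omega
        · rw [f0]; exact h1
        · rw [f0]; exact h2
        · rw [f1, g0, hcard]; omega
        · rw [g0]; omega
        · rw [g0]; omega
      · have k1 := t1' fun h => h0' (agree true true (by rwa [f1]))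
        refine exactAt_of_not_compRel_true halt hc h0'
          (ih _ _ (hcomp _ h0) ?_ ?_ ?_ hcard)
        · rw [f0, g1, hcard]; omega
        · rw [f0]; omega
        · rw [f0]; omega
    · have hr : ¬ D.rel (fill U false α) (D.ptA c) (D.ptB c) := fun h =>
        h0 (agree false false (by rwa [f0]))
      have k0 := t0' hr
      have h0' : compRel (U.erase c) (Function.update α c true) (D.ptA c) (D.ptB c) :=
        agree true false (by rw [g0]; exact rel_toggle_of_not halt hr)
      refine exactAt_of_not_compRel_false halt hc h0 (ih _ _ (hcomp _ h0') ?_ ?_ ?_ hcard)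
      · rw [f1, g0, hcard]; omega
      · rw [g0]; omega
      · rw [g0]; omega

/-! ### The Khovanov complex as a part of the total chain space -/

open scoped Classical in
/-- A chain of one bidegree as an element of the total chain space. -/
noncomputable def toTotal {i j : ℤ} (x : D.Chain i j) : Total D :=
  fun S => if h : hDeg S = i ∧ qDeg S = j then x ⟨S, h⟩ else 0

theorem toTotal_apply {i j : ℤ} (x : D.Chain i j) (S : D.Gen i j) : toTotal x S.1 = x S :=
  dif_pos S.2

theorem qDeg_eq (S : D.EnhancedState) :
    qDeg S = deg S + (ones S.1 : ℤ) + (D.nPos : ℤ) - 2 * (D.nNeg : ℤ) := rfl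

theorem partialDiff_univ_apply (halt : D.Alternating) (y : Total D) (T : D.EnhancedState) :
    partialDiff Finset.univ y T = ∑ S, (∑ m, edgeCoeff m S T) * y S := by
  rw [partialDiff_apply, Finset.sum_apply]
  simp only [signedMap_eq, edgeMap_apply, diagOp_apply, Finset.sum_mul]
  rw [Finset.sum_comm]
  refine Finset.sum_congr rfl fun S _ => Finset.sum_congr rfl fun m _ => ?_
  rw [edgeCoeff_eq halt, faceSign]
  split_ifs <;> ring

theorem diff_apply (halt : D.Alternating) {i i' j : ℤ} (x : D.Chain i j) (T : D.Gen i' j) :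
    D.diff i i' j x T = partialDiff Finset.univ (toTotal x) T.1 := by
  rw [partialDiff_univ_apply halt]
  refine Fintype.sum_of_injective (Subtype.val : D.Gen i j → D.EnhancedState)
    Subtype.val_injective _ _ (fun S hS => ?_) fun S => ?_
  · rw [toTotal, dif_neg (fun h => hS ⟨⟨S, h⟩, rfl⟩), mul_zero]
  · rw [toTotal_apply]; rfl

/-- The homology vanishes in every bidegree in which the total complex is exact. -/
theorem subsingleton_Kh (halt : D.Alternating) {i j d r : ℤ} {α : D.State}
    (hr : r = i + D.nNeg) (hd : d = j - r - D.nPos + 2 * D.nNeg)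
    (H : ExactAt Finset.univ α d r) : ¬ Nontrivial (D.Kh i j) := by
  rw [not_nontrivial_iff_subsingleton, Submodule.Quotient.subsingleton_iff,
    eq_top_iff]
  rintro ⟨x, hx⟩ -
  rw [LinearMap.mem_ker] at hx
  change x ∈ LinearMap.range (D.diff (i - 1) i j)
  have gen : ∀ {S : D.EnhancedState}, hDeg S = i ∧ qDeg S = j → deg S = d ∧ (ones S.1 : ℤ) = r := by
    rintro S ⟨h1, h2⟩
    rw [hDeg] at h1
    rw [qDeg_eq] at h2
    constructor <;> linarith
  have hxm : toTotal x ∈ part Finset.univ α d r := by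
    intro S hS
    refine ⟨fun c hc => absurd (Finset.mem_univ c) hc, gen ?_⟩
    by_contra h
    exact hS (dif_neg h)
  have hdx : partialDiff Finset.univ (toTotal x) = 0 := by
    funext T
    by_contra hT
    obtain ⟨-, h1, h2⟩ := partialDiff_mem hxm T hT
    have hT' : hDeg T = i + 1 ∧ qDeg T = j := by
      rw [hDeg, qDeg_eq]; constructor <;> linarith
    rw [← diff_apply halt x ⟨T, hT'⟩, hx] at hT
    exact hT rfl
  obtain ⟨y, hy, hyx⟩ := H _ hxm hdx
  refine ⟨fun S => y S.1, ?_⟩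
  have hy' : toTotal (fun S : D.Gen (i - 1) j => y S.1) = y := by
    funext S
    by_cases h : hDeg S = i - 1 ∧ qDeg S = j
    · exact dif_pos h
    · refine (dif_neg h).trans ?_
      by_contra hS
      obtain ⟨-, h1, h2⟩ := hy S (fun e => hS e.symm)
      refine h ?_
      rw [hDeg, qDeg_eq]; constructor <;> linarith
  funext T
  rw [diff_apply halt, hy', hyx]
  exact toTotal_apply x T

/-! ### Checkerboard colorings of alternating diagrams -/

theorem isUpper_sub_one (c : Fin D.n) (k : Fin 4) :
    D.isUpper (c, k - 1) = !D.isUpper (c, k) := by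
  rcases fin4_cases k with rfl | rfl | rfl | rfl <;>
    (simp [isUpper]; try decide)

theorem isUpper_cornerStep (halt : D.Alternating) {h h' : D.HalfEdge} (e : D.cornerStep h h') :
    D.isUpper h' = D.isUpper h := by
  rw [e, isUpper_sub_one, isUpper_mate halt, Bool.not_not]

theorem corner_mate_sub_one (h : D.HalfEdge) :
    D.corner ((D.mate h).1, (D.mate h).2 - 1) = D.corner h :=
  congrArg Sum.inl (@Quot.sound _ D.cornerStep h _ rfl).symm

/-- The coloring of an alternating diagram whose white regions lie counterclockwise after the
half-edges of the upper strands, or after those of the lower strands. -/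
def altColoring (halt : D.Alternating) (b : Bool) : D.Coloring where
  white := Sum.elim (Quot.lift (fun h => D.isUpper h == b) fun h h' e => by
    rw [isUpper_cornerStep halt e]) fun x => x.2 == b
  edge_ne := by
    rintro ⟨c, k⟩
    change (D.isUpper (c, k) == b) ≠ (D.isUpper (c, k - 1) == b)
    rw [isUpper_sub_one]
    cases D.isUpper (c, k) <;> cases b <;> simp
  loop_ne := by
    intro l
    cases b <;> simp

theorem altColoring_white_corner (halt : D.Alternating) (b : Bool) (h : D.HalfEdge) :
    (altColoring halt b).white (D.corner h) = (D.isUpper h == b) := rfl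

theorem altColoring_white_not (halt : D.Alternating) (b : Bool) (f : D.Face) :
    (altColoring halt (!b)).white f = !(altColoring halt b).white f := by
  rcases f with z | ⟨l, s⟩
  · obtain ⟨h, rfl⟩ := Quot.exists_rep z
    change (D.isUpper h == !b) = !(D.isUpper h == b)
    cases D.isUpper h <;> cases b <;> rfl
  · change (s == !b) = !(s == b)
    cases s <;> cases b <;> rfl

/-- The white regions lie counterclockwise after the half-edges of the upper strands (if `b`) or
after those of the lower strands. -/
def IsType (ξ : D.Coloring) (b : Bool) : Prop :=
  ∀ h : D.HalfEdge, ξ.white (D.corner h) = (D.isUpper h == b)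

theorem subsingleton_of_connected (hconn : D.Connected) :
    Subsingleton (Quot D.linked ⊕ Fin D.loops) :=
  (Nat.card_eq_one_iff_unique.1 hconn).1

/-- A function on the half-edges of a connected diagram is constant if it is constant along edges
and at crossings. -/
theorem eq_of_linked {β : Type} (hconn : D.Connected) (f : D.HalfEdge → β)
    (h1 : ∀ h, f (D.mate h) = f h) (h2 : ∀ c k k', f (c, k) = f (c, k'))
    (h h' : D.HalfEdge) : f h = f h' := by
  have hs := subsingleton_of_connected hconn
  have key : ∀ x y, D.linked x y → f x = f y := by
    rintro x ⟨c, k⟩ (e | e)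
    · rw [e, h1]
    · obtain ⟨c', k'⟩ := x
      obtain rfl : c = c' := e
      exact h2 _ _ _
  have e : Quot.mk D.linked h = Quot.mk D.linked h' :=
    Sum.inl_injective (Subsingleton.elim (α := Quot D.linked ⊕ Fin D.loops) _ _)
  exact congrArg (Quot.lift f key) e

/-- The white regions of every coloring of a connected alternating diagram are of one type. -/
theorem exists_isType (hconn : D.Connected) (halt : D.Alternating) (ξ : D.Coloring) :
    ∃ b, IsType ξ b := by
  have hsub : ∀ c k, ξ.white (D.corner (c, k - 1)) = !ξ.white (D.corner (c, k)) := by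
    intro c k
    have := ξ.edge_ne (c, k)
    revert this
    cases ξ.white (D.corner (c, k)) <;> cases ξ.white (D.corner (c, k - 1)) <;> simp
  have key := eq_of_linked hconn (fun h => xor (ξ.white (D.corner h)) (D.isUpper h))
    (fun h => by
      have e := hsub (D.mate h).1 (D.mate h).2
      rw [corner_mate_sub_one] at e
      simp only [e, isUpper_mate halt]
      cases ξ.white (D.corner (D.mate h)) <;> cases D.isUpper h <;> rfl)
    (fun c k k' => by
      have step : ∀ k, xor (ξ.white (D.corner (c, k - 1))) (D.isUpper (c, k - 1)) =
          xor (ξ.white (D.corner (c, k))) (D.isUpper (c, k)) := fun k => by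
        rw [hsub, isUpper_sub_one]
        cases ξ.white (D.corner (c, k)) <;> cases D.isUpper (c, k) <;> rfl
      have all : ∀ k, xor (ξ.white (D.corner (c, k))) (D.isUpper (c, k)) =
          xor (ξ.white (D.corner (c, 3))) (D.isUpper (c, 3)) := fun k => by
        have s1 := step 1
        have s2 := step 2
        have s3 := step 3
        rcases fin4_cases k with rfl | rfl | rfl | rfl
        · exact (s1.trans s2).trans s3
        · exact s2.trans s3
        · exact s3
        · rfl
      rw [all k, all k'])
  by_cases hne : Nonempty D.HalfEdge
  · obtain ⟨g⟩ := hne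
    refine ⟨!xor (ξ.white (D.corner g)) (D.isUpper g), fun h => ?_⟩
    rw [← key h g]
    cases ξ.white (D.corner h) <;> cases D.isUpper h <;> rfl
  · exact ⟨true, fun h => absurd ⟨h⟩ hne⟩

/-! ### White regions and the cycles of the extreme states -/

/-- The state with the same smoothing at all crossings. -/
def constState (D : LinkDiagram) (b : Bool) : D.State := fun _ => b

theorem smoothArc_constState {b : Bool} {h : D.HalfEdge} (hb : D.isUpper h = !b) :
    D.smoothArc (constState D b) h = (h.1, h.2 - 1) := by
  obtain ⟨c, k⟩ := h
  rcases fin4_cases k with rfl | rfl | rfl | rfl <;> cases b <;>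
    (simp [smoothArc, constState, isUpper] at hb ⊢; try decide)

/-- Of the two half-edges of an arc in the state `constState D b`, the one in front of the corner
that is cut off by the arc. -/
def cornerEdge (b : Bool) (h : D.HalfEdge) : D.HalfEdge :=
  if D.isUpper h = b then h else (h.1, h.2 - 1)

theorem isUpper_cornerEdge (b : Bool) (h : D.HalfEdge) : D.isUpper (cornerEdge b h) = b := by
  unfold cornerEdge
  split_ifs with e
  · exact e
  · rw [isUpper_sub_one, Bool.not_eq]; exact e

theorem cornerEdge_of_eq {b : Bool} {h : D.HalfEdge} (e : D.isUpper h = b) :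
    cornerEdge b h = h := if_pos e

theorem corner_cornerEdge_mate (halt : D.Alternating) (b : Bool) (h : D.HalfEdge) :
    D.corner (cornerEdge b (D.mate h)) = D.corner (cornerEdge b h) := by
  have key : ∀ h, D.isUpper h = b →
      D.corner (cornerEdge b (D.mate h)) = D.corner (cornerEdge b h) := by
    intro h e
    have e' : D.isUpper (D.mate h) ≠ b := by rw [isUpper_mate halt, e]; simp
    rw [cornerEdge_of_eq e, cornerEdge, if_neg e', corner_mate_sub_one]
  by_cases e : D.isUpper h = b
  · exact key h e
  · have := key (D.mate h) (by rw [isUpper_mate halt, Bool.not_eq]; exact e)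
    rw [D.mate_mate] at this
    exact this.symm

theorem cornerEdge_smoothArc (b : Bool) (h : D.HalfEdge) :
    cornerEdge b (D.smoothArc (constState D b) h) = cornerEdge b h := by
  by_cases e : D.isUpper h = b
  · have e' : D.isUpper (D.smoothArc (constState D b) h) = !b := by rw [isUpper_smoothArc, e]
    have e'' : D.isUpper (D.smoothArc (constState D b) h) ≠ b := by rw [e']; simp
    rw [cornerEdge_of_eq e, cornerEdge, if_neg e'', ← smoothArc_constState e',
      smoothArc_smoothArc]
  · have e' : D.isUpper h = !b := by revert e; cases D.isUpper h <;> cases b <;> simp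
    rw [smoothArc_constState e', cornerEdge_of_eq (by rw [isUpper_sub_one, e', Bool.not_not]),
      cornerEdge, if_neg e]

theorem cyc_cornerEdge (b : Bool) (h : D.HalfEdge) :
    D.cyc (constState D b) (cornerEdge b h) = D.cyc (constState D b) h := by
  unfold cornerEdge
  split_ifs with e
  · rfl
  · have e' : D.isUpper h = !b := by revert e; cases D.isUpper h <;> cases b <;> simp
    rw [← smoothArc_constState e']
    exact (rel_smoothArc (constState D b) h).symm

/-- The region next to a cycle of the state `constState D b`, on the side of the corners that are
cut off by its arcs; for a component without crossings, its white side. -/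
def regionOf (halt : D.Alternating) (ξ : D.Coloring) (b : Bool) :
    D.Cycle (constState D b) → D.Face :=
  Sum.elim (Quot.lift (fun h => D.corner (cornerEdge b h)) fun h h' e => by
      rcases e with rfl | rfl
      · exact (corner_cornerEdge_mate halt b h).symm
      · rw [cornerEdge_smoothArc])
    fun l => Sum.inr (l, ξ.white (Sum.inr (l, true)))

theorem white_loop_iff (ξ : D.Coloring) (l : Fin D.loops) (s : Bool) :
    ξ.white (Sum.inr (l, s)) = true ↔ s = ξ.white (Sum.inr (l, true)) := by
  have := ξ.loop_ne l
  revert this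
  cases s <;> cases ξ.white (Sum.inr (l, true)) <;> cases ξ.white (Sum.inr (l, false)) <;> simp

theorem white_regionOf (halt : D.Alternating) {ξ : D.Coloring} {b : Bool} (hξ : IsType ξ b)
    (z : D.Cycle (constState D b)) : ξ.white (regionOf halt ξ b z) = true := by
  rcases z with z | l
  · obtain ⟨h, rfl⟩ := Quot.exists_rep z
    change ξ.white (D.corner (cornerEdge b h)) = true
    rw [hξ, isUpper_cornerEdge]
    simp
  · exact (white_loop_iff ξ l _).2 rfl

theorem regionOf_injective (halt : D.Alternating) (ξ : D.Coloring) (b : Bool) :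
    Function.Injective (regionOf halt ξ b) := by
  have key : ∀ h h' : D.HalfEdge, D.isUpper h = b → D.isUpper h' = b →
      D.corner h = D.corner h' → D.cyc (constState D b) h = D.cyc (constState D b) h' := by
    intro h h' e e' heq
    let f : Quot D.cornerStep → Option (D.Cycle (constState D b)) :=
      Quot.lift (fun g => if D.isUpper g = b then some (D.cyc (constState D b) g) else none)
        fun g g' k => by
          rw [isUpper_cornerStep halt k]
          split_ifs with hg
          · have hm : D.isUpper (D.mate g) = !b := by rw [isUpper_mate halt, hg]
            rw [k, ← smoothArc_constState hm]
            congr 1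
            exact (rel_mate (constState D b) g).trans (rel_smoothArc (constState D b) _)
          · rfl
    have := congrArg f (Sum.inl_injective heq)
    simpa [f, e, e'] using this
  rintro (z | l) (w | l') e
  · obtain ⟨h, rfl⟩ := Quot.exists_rep z
    obtain ⟨h', rfl⟩ := Quot.exists_rep w
    change D.cyc (constState D b) h = D.cyc (constState D b) h'
    rw [← cyc_cornerEdge, ← cyc_cornerEdge b h']
    exact key _ _ (isUpper_cornerEdge b h) (isUpper_cornerEdge b h') e
  · obtain ⟨h, rfl⟩ := Quot.exists_rep z
    exact absurd (show Sum.inl _ = Sum.inr _ from e) (by simp)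
  · obtain ⟨h', rfl⟩ := Quot.exists_rep w
    exact absurd (show Sum.inr _ = Sum.inl _ from e) (by simp)
  · have : (l, ξ.white (Sum.inr (l, true))) = (l', ξ.white (Sum.inr (l', true))) :=
      Sum.inr_injective e
    exact congrArg Sum.inr (Prod.ext_iff.1 this).1

theorem exists_regionOf (halt : D.Alternating) {ξ : D.Coloring} {b : Bool} (hξ : IsType ξ b)
    {f : D.Face} (hf : ξ.white f = true) : ∃ z, regionOf halt ξ b z = f := by
  rcases f with z | ⟨l, s⟩
  · obtain ⟨h, rfl⟩ := Quot.exists_rep z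
    have hb : D.isUpper h = b := by
      have := hξ h
      rw [show ξ.white (D.corner h) = true from hf] at this
      simpa using this.symm
    exact ⟨D.cyc (constState D b) h, congrArg D.corner (cornerEdge_of_eq hb)⟩
  · exact ⟨Sum.inr l, by rw [(white_loop_iff ξ l s).1 hf]; rfl⟩

theorem card_whiteRegion (halt : D.Alternating) {ξ : D.Coloring} {b : Bool} (hξ : IsType ξ b) :
    Fintype.card (WhiteRegion ξ) = cycleCount (constState D b) := by
  refine (Fintype.card_of_bijective
    (f := fun z => (⟨regionOf halt ξ b z, white_regionOf halt hξ z⟩ : WhiteRegion ξ))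
    ⟨fun z w e => ?_, fun f => ?_⟩).symm
  · exact regionOf_injective halt ξ b (congrArg Subtype.val e)
  · obtain ⟨z, hz⟩ := exists_regionOf halt hξ f.2
    exact ⟨z, Subtype.ext hz⟩

theorem card_face (halt : D.Alternating) :
    Fintype.card D.Face = cycleCount (constState D false) + cycleCount (constState D true) := by
  classical
  rw [← card_whiteRegion halt (altColoring_white_corner halt false : IsType _ false),
    ← card_whiteRegion halt (altColoring_white_corner halt true : IsType _ true),
    ← Fintype.card_congr (Equiv.sumCompl fun f => (altColoring halt false).white f = true),
    Fintype.card_sum]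
  congr 1
  refine Fintype.card_congr (Equiv.subtypeEquivRight fun f => ?_)
  have := altColoring_white_not halt false f
  rw [Bool.not_false] at this
  rw [this]
  simp

/-- For a diagram on the sphere, the Euler characteristic gives the number of cycles in the two
extreme states. -/
theorem cycleCount_add_cycleCount (halt : D.Alternating) (hclassical : D.HasGenus 0) :
    cycleCount (constState D false) + cycleCount (constState D true) = D.n + 2 := by
  have h : D.eulerChar = 2 - 2 * ((0 : ℕ) : ℤ) := hclassical
  rw [eulerChar, card_face halt] at h
  push_cast at h
  omega

/-- A connected diagram is connected when no crossing is smoothed. -/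
theorem card_compRel_univ (hconn : D.Connected) (α : D.State) :
    Nat.card (Quotient (compRel Finset.univ α)) = 1 := by
  have hs := subsingleton_of_connected hconn
  have hne : Nonempty (Quot D.linked ⊕ Fin D.loops) := (Nat.card_eq_one_iff_unique.1 hconn).2
  rw [Nat.card_eq_one_iff_unique]
  constructor
  · constructor
    intro z w
    induction z using Quotient.inductionOn with | _ p
    induction w using Quotient.inductionOn with | _ q
    rcases p with h | l <;> rcases q with h' | l'
    · refine eq_of_linked hconn (fun h => Quotient.mk (compRel Finset.univ α) (Sum.inl h))
        (fun g => ?_) (fun c k k' => ?_) h h'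
      · exact Quotient.sound (Setoid.symm' _ (rel_le_compRel _ _ (rel_mate α g)))
      · have key := rel_at_crossing (rel_le_compRel Finset.univ α)
          (compRel_pair α (Finset.mem_univ c))
        exact Quotient.sound (Setoid.trans' _ (Setoid.symm' _ (key k)) (key k'))
    · exact absurd (Subsingleton.elim (α := Quot D.linked ⊕ Fin D.loops)
        (Sum.inl (Quot.mk _ h)) (Sum.inr l')) (by simp)
    · exact absurd (Subsingleton.elim (α := Quot D.linked ⊕ Fin D.loops)
        (Sum.inl (Quot.mk _ h')) (Sum.inr l)) (by simp)
    · rw [Sum.inr_injective (Subsingleton.elim (α := Quot D.linked ⊕ Fin D.loops)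
        (Sum.inr l) (Sum.inr l'))]
  · obtain ⟨z | l⟩ := hne
    · obtain ⟨h, rfl⟩ := Quot.exists_rep z
      exact ⟨Quotient.mk _ (Sum.inl h)⟩
    · exact ⟨Quotient.mk _ (Sum.inr l)⟩

/-! ### Definite Goeritz matrices -/

/-- The signature of a definite matrix. -/
theorem _root_.symmSignature_of_definite {ι : Type} [Fintype ι] (A : Matrix ι ι ℤ)
    (hA : A.IsSymm) {b : Bool}
    (h : ∀ x : ι → ℝ, x ≠ 0 →
      0 < (if b then -1 else 1) * (x ⬝ᵥ (A.map fun a : ℤ => (a : ℝ)).mulVec x)) :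
    symmSignature A hA = (if b then -1 else 1) * (Fintype.card ι : ℤ) := by
  classical
  have hH : (A.map (fun x : ℤ => (x : ℝ))).IsHermitian := by
    ext i j
    simp [Matrix.conjTranspose_apply, hA.apply]
  have key : ∀ i, 0 < (if b then -1 else 1) * hH.eigenvalues i := by
    intro i
    have h0 : (hH.eigenvectorBasis i : ι → ℝ) ≠ 0 := by
      intro e
      have := hH.eigenvectorBasis.orthonormal.ne_zero i
      exact this (by ext j; exact congrFun e j)
    have h1 := h _ h0
    have h2 := hH.eigenvalues_eq i
    rw [h2]
    simpa using h1
  have hcard : symmSignature A hA = (Nat.card {i : ι // 0 < hH.eigenvalues i} : ℤ) -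
      (Nat.card {i : ι // hH.eigenvalues i < 0} : ℤ) := rfl
  rw [hcard]
  cases b
  · have k : ∀ i, 0 < hH.eigenvalues i := fun i => by simpa using key i
    have e1 : Nat.card {i : ι // 0 < hH.eigenvalues i} = Fintype.card ι := by
      rw [← Nat.card_eq_fintype_card]
      exact Nat.card_congr (Equiv.subtypeUnivEquiv k)
    have e2 : IsEmpty {i : ι // hH.eigenvalues i < 0} := ⟨fun i => lt_asymm (k i.1) i.2⟩
    rw [e1, Nat.card_of_isEmpty]
    simp
  · have k : ∀ i, hH.eigenvalues i < 0 := fun i => by simpa using key i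
    have e1 : Nat.card {i : ι // hH.eigenvalues i < 0} = Fintype.card ι := by
      rw [← Nat.card_eq_fintype_card]
      exact Nat.card_congr (Equiv.subtypeUnivEquiv k)
    have e2 : IsEmpty {i : ι // 0 < hH.eigenvalues i} := ⟨fun i => lt_asymm (k i.1) i.2⟩
    rw [e1, Nat.card_of_isEmpty]
    simp

theorem incidence_of_isType {ξ : D.Coloring} {b : Bool} (hξ : IsType ξ b) (c : Fin D.n) :
    incidence ξ c = if b then -1 else 1 := by
  rw [incidence, hξ]
  cases b <;> simp [isUpper]

theorem nPos_add_nNeg : D.nPos + D.nNeg = D.n := by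
  have := Finset.card_filter_add_card_filter_not (s := (Finset.univ : Finset (Fin D.n)))
    (fun c => D.positive c = true)
  simpa [nPos, nNeg] using this

theorem correction_of_isType {ξ : D.Coloring} {b : Bool} (hξ : IsType ξ b) :
    correction ξ = if b then -(D.nNeg : ℤ) else (D.nPos : ℤ) := by
  classical
  unfold correction
  simp only [incidence_of_isType hξ, writhe]
  cases b
  · have : (Finset.univ.filter fun c => (if D.positive c = true then (1 : ℤ) else -1) *
        (if false = true then -1 else 1) = 1) =
          Finset.univ.filter fun c => D.positive c = true := by
      ext c
      by_cases h : D.positive c = true <;> simp [h]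
    rw [this]
    simp [nPos]
  · have : (Finset.univ.filter fun c => (if D.positive c = true then (1 : ℤ) else -1) *
        (if true = true then -1 else 1) = 1) =
          Finset.univ.filter fun c => D.positive c = false := by
      ext c
      by_cases h : D.positive c = true <;> simp [h]
    rw [this]
    simp [nNeg]

/-- A function on the white regions of a connected diagram is constant if it takes the same value
on the two white regions at every crossing. -/
theorem eq_of_adjacent (hconn : D.Connected) (halt : D.Alternating) {ξ : D.Coloring} {b : Bool}
    (hξ : IsType ξ b) (y : WhiteRegion ξ → ℝ)
    (hy : ∀ c (X Y : WhiteRegion ξ), Adjacent c X.1 → Adjacent c Y.1 → y X = y Y)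
    (X Y : WhiteRegion ξ) : y X = y Y := by
  have hs := subsingleton_of_connected hconn
  have hw : ∀ h, ξ.white (D.corner (cornerEdge b h)) = true := fun h => by
    rw [hξ, isUpper_cornerEdge]; simp
  have hadj : ∀ c k, Adjacent c (D.corner (cornerEdge b (c, k))) := fun c k => by
    unfold cornerEdge
    split_ifs
    · exact ⟨k, rfl⟩
    · exact ⟨k - 1, rfl⟩
  have key := eq_of_linked hconn (fun h => y ⟨_, hw h⟩)
    (fun h => congrArg y (Subtype.ext (corner_cornerEdge_mate halt b h)))
    (fun c k k' => hy c _ _ (hadj c k) (hadj c k'))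
  have hX : ∀ X : WhiteRegion ξ, (∃ h, X.1 = D.corner (cornerEdge b h)) ∨
      ∃ l, X.1 = Sum.inr (l, ξ.white (Sum.inr (l, true))) := by
    intro X
    obtain ⟨z | l, hz⟩ := exists_regionOf halt hξ X.2
    · obtain ⟨h, rfl⟩ := Quot.exists_rep z
      exact Or.inl ⟨h, hz.symm⟩
    · exact Or.inr ⟨l, hz.symm⟩
  rcases hX X with ⟨h, e⟩ | ⟨l, e⟩ <;> rcases hX Y with ⟨h', e'⟩ | ⟨l', e'⟩
  · rw [show X = ⟨_, hw h⟩ from Subtype.ext e, show Y = ⟨_, hw h'⟩ from Subtype.ext e']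
    exact key h h'
  · exact absurd (Subsingleton.elim (α := Quot D.linked ⊕ Fin D.loops)
        (Sum.inl (Quot.mk _ h)) (Sum.inr l')) (by simp)
  · exact absurd (Subsingleton.elim (α := Quot D.linked ⊕ Fin D.loops)
        (Sum.inl (Quot.mk _ h')) (Sum.inr l)) (by simp)
  · have : l = l' := Sum.inr_injective (Subsingleton.elim (α := Quot D.linked ⊕ Fin D.loops)
        (Sum.inr l) (Sum.inr l'))
    subst this
    exact congrArg y (Subtype.ext (e.trans e'.symm))

open scoped Classical in
/-- The number of crossings adjacent to two regions. -/
noncomputable def adjCount (ξ : D.Coloring) (X Y : WhiteRegion ξ) : ℕ :=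
  (Finset.univ.filter fun c => Adjacent c X.1 ∧ Adjacent c Y.1).card

theorem adjCount_comm (ξ : D.Coloring) (X Y : WhiteRegion ξ) :
    adjCount ξ X Y = adjCount ξ Y X := by
  unfold adjCount
  congr 1
  ext c
  simp [and_comm]

theorem goeritzOff_of_isType {ξ : D.Coloring} {b : Bool} (hξ : IsType ξ b) (X Y : WhiteRegion ξ) :
    goeritzOff ξ X Y = -((if b then -1 else 1) * (adjCount ξ X Y : ℤ)) := by
  classical
  unfold goeritzOff adjCount
  simp only [incidence_of_isType hξ]
  rw [Finset.sum_const, nsmul_eq_mul, mul_comm]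

/-- The Goeritz matrix before the removal of a region is a graph Laplacian, up to the sign of the
crossings. -/
theorem preGoeritz_mulVec {ξ : D.Coloring} {b : Bool} (hξ : IsType ξ b) (y : WhiteRegion ξ → ℝ)
    (X : WhiteRegion ξ) : ∑ Y, (preGoeritz ξ X Y : ℝ) * y Y =
      (if b then -1 else 1) * ∑ Y, (adjCount ξ X Y : ℝ) * (y X - y Y) := by
  classical
  have hoff : ∀ Y, (goeritzOff ξ X Y : ℝ) = -((if b then -1 else 1) * (adjCount ξ X Y : ℝ)) := by
    intro Y
    rw [goeritzOff_of_isType hξ]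
    push_cast
    cases b <;> simp
  rw [← Finset.add_sum_erase _ _ (Finset.mem_univ X),
    ← Finset.add_sum_erase (a := X) _ (fun Y => (adjCount ξ X Y : ℝ) * (y X - y Y))
      (Finset.mem_univ X), sub_self, mul_zero, zero_add, Finset.mul_sum]
  have h1 : (preGoeritz ξ X X : ℝ) =
      ∑ Y ∈ Finset.univ.erase X, (if b then -1 else 1) * (adjCount ξ X Y : ℝ) := by
    rw [preGoeritz, if_pos rfl]
    push_cast
    rw [← Finset.sum_neg_distrib]
    exact Finset.sum_congr rfl fun Y _ => by rw [hoff, neg_neg]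
  rw [h1, Finset.sum_mul, ← Finset.sum_add_distrib]
  refine Finset.sum_congr rfl fun Y hY => ?_
  rw [preGoeritz, if_neg (Finset.ne_of_mem_erase hY).symm, hoff]
  ring

theorem preGoeritz_form {ξ : D.Coloring} {b : Bool} (hξ : IsType ξ b) (y : WhiteRegion ξ → ℝ) :
    2 * ∑ X, y X * ∑ Y, (preGoeritz ξ X Y : ℝ) * y Y =
      (if b then -1 else 1) * ∑ X, ∑ Y, (adjCount ξ X Y : ℝ) * (y X - y Y) ^ 2 := by
  simp only [preGoeritz_mulVec hξ]
  have e1 : ∑ X, y X * ((if b then -1 else 1) * ∑ Y, (adjCount ξ X Y : ℝ) * (y X - y Y)) =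
      (if b then -1 else 1) * ∑ X, ∑ Y, (adjCount ξ X Y : ℝ) * (y X * (y X - y Y)) := by
    rw [Finset.mul_sum]
    refine Finset.sum_congr rfl fun X _ => ?_
    simp only [Finset.mul_sum]
    exact Finset.sum_congr rfl fun Y _ => by ring
  have e2 : ∑ X, ∑ Y, (adjCount ξ X Y : ℝ) * (y X * (y X - y Y)) =
      ∑ X, ∑ Y, (adjCount ξ X Y : ℝ) * (y Y * (y Y - y X)) := by
    rw [Finset.sum_comm]
    refine Finset.sum_congr rfl fun X _ => Finset.sum_congr rfl fun Y _ => ?_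
    rw [adjCount_comm]
  rw [e1, mul_left_comm, two_mul]
  congr 1
  conv_lhs => rw [e2]
  nth_rewrite 2 [← e2]
  rw [← Finset.sum_add_distrib]
  refine Finset.sum_congr rfl fun X _ => ?_
  rw [← Finset.sum_add_distrib]
  exact Finset.sum_congr rfl fun Y _ => by ring

/-- Up to the sign of the crossings, the Goeritz matrix is positive definite. -/
theorem goeritz_definite (hconn : D.Connected) (halt : D.Alternating) {ξ : D.Coloring} {b : Bool}
    (hξ : IsType ξ b) (X₀ : WhiteRegion ξ) [Fintype {X : WhiteRegion ξ // X ≠ X₀}]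
    (x : {X : WhiteRegion ξ // X ≠ X₀} → ℝ) (hx : x ≠ 0) :
    0 < (if b then -1 else 1) *
      (x ⬝ᵥ ((goeritz ξ X₀).map fun a : ℤ => (a : ℝ)).mulVec x) := by
  classical
  -- Extend the vector by zero to the removed region.
  let y : WhiteRegion ξ → ℝ := fun X => if h : X ≠ X₀ then x ⟨X, h⟩ else 0
  have hy0 : y X₀ = 0 := dif_neg (by simp)
  have hyx : ∀ X : {X : WhiteRegion ξ // X ≠ X₀}, y X.1 = x X := fun X => dif_pos X.2
  have hsum : ∀ f : WhiteRegion ξ → ℝ, ∑ X, f X * y X = ∑ X : {X // X ≠ X₀}, f X.1 * x X := by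
    intro f
    symm
    refine Fintype.sum_of_injective (Subtype.val : {X : WhiteRegion ξ // X ≠ X₀} → _)
      Subtype.val_injective _ _ (fun X hX => ?_) fun X => ?_
    · have : ¬ X ≠ X₀ := fun h => hX ⟨⟨X, h⟩, rfl⟩
      rw [show y X = 0 from dif_neg this, mul_zero]
    · rw [hyx]
  have hform : x ⬝ᵥ ((goeritz ξ X₀).map fun a : ℤ => (a : ℝ)).mulVec x =
      ∑ X, y X * ∑ Y, (preGoeritz ξ X Y : ℝ) * y Y := by
    simp only [mul_comm (y _), hsum]
    refine Finset.sum_congr rfl fun X _ => ?_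
    rw [mul_comm]
    rfl
  have h2 := preGoeritz_form hξ y
  rw [← hform] at h2
  have hnn : ∀ X Y : WhiteRegion ξ, 0 ≤ (adjCount ξ X Y : ℝ) * (y X - y Y) ^ 2 := fun X Y =>
    by positivity
  have hpos : 0 < ∑ X, ∑ Y, (adjCount ξ X Y : ℝ) * (y X - y Y) ^ 2 := by
    refine lt_of_le_of_ne (Finset.sum_nonneg fun X _ => Finset.sum_nonneg fun Y _ => hnn X Y)
      fun h0 => hx ?_
    have hz : ∀ X Y, (adjCount ξ X Y : ℝ) * (y X - y Y) ^ 2 = 0 := fun X Y => by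
      have h3 := (Finset.sum_eq_zero_iff_of_nonneg fun X _ =>
        Finset.sum_nonneg fun Y _ => hnn X Y).1 h0.symm X (Finset.mem_univ X)
      exact (Finset.sum_eq_zero_iff_of_nonneg fun Y _ => hnn X Y).1 h3 Y (Finset.mem_univ Y)
    have hc := eq_of_adjacent hconn halt hξ y fun c X Y hX hY => by
      have hne : (adjCount ξ X Y : ℝ) ≠ 0 := by
        rw [Nat.cast_ne_zero]
        exact (Finset.card_pos.2 ⟨c, Finset.mem_filter.2 ⟨Finset.mem_univ c, hX, hY⟩⟩).ne'
      have := (mul_eq_zero.1 (hz X Y)).resolve_left hne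
      exact sub_eq_zero.1 (pow_eq_zero_iff two_ne_zero |>.1 this)
    funext X
    rw [← hyx, hc X.1 X₀, hy0]; rfl
  cases b
  · simp only [Bool.false_eq_true, if_false, one_mul] at h2 ⊢
    linarith
  · simp only [if_true] at h2 ⊢
    linarith

theorem signature_of_isType (hconn : D.Connected) (halt : D.Alternating) {ξ : D.Coloring}
    {b : Bool} (hξ : IsType ξ b) (X₀ : WhiteRegion ξ) :
    signature ξ X₀ = (if b then -1 else 1) * ((cycleCount (constState D b) : ℤ) - 1) -
      if b then -(D.nNeg : ℤ) else (D.nPos : ℤ) := by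
  classical
  rw [signature, correction_of_isType hξ, symmSignature_of_definite _ _
    (goeritz_definite hconn halt hξ X₀), ← card_whiteRegion halt hξ]
  have h1 : Fintype.card {X : WhiteRegion ξ // X ≠ X₀} = Fintype.card (WhiteRegion ξ) - 1 := by
    rw [Fintype.card_subtype_compl, Fintype.card_subtype_eq]
  have h2 : 0 < Fintype.card (WhiteRegion ξ) := Fintype.card_pos_iff.2 ⟨X₀⟩
  have h3 : (Fintype.card {X : WhiteRegion ξ // X ≠ X₀} : ℤ) =
      (Fintype.card (WhiteRegion ξ) : ℤ) - 1 := by omega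
  rw [← h3]

theorem signature_eq (hconn : D.Connected) (hclassical : D.HasGenus 0) (halt : D.Alternating)
    (ξ : D.Coloring) (X₀ : WhiteRegion ξ) :
    signature ξ X₀ = (cycleCount (constState D false) : ℤ) - 1 - D.nPos := by
  obtain ⟨b, hb⟩ := exists_isType hconn halt ξ
  rw [signature_of_isType hconn halt hb]
  have h1 := cycleCount_add_cycleCount halt hclassical
  have h2 := D.nPos_add_nNeg
  cases b
  · simp
  · simp only [if_true]; omega

end LinkDiagram

theorem mainTheorem10 (D : LinkDiagram) (hconn : D.Connected) (hclassical : D.HasGenus 0)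
    (halt : D.Alternating) :
    ∃ σ : ℤ,
      (∃ (ξ : D.Coloring) (X₀ : LinkDiagram.WhiteRegion ξ), LinkDiagram.signature ξ X₀ = σ) ∧
      (∀ (ξ : D.Coloring) (X₀ : LinkDiagram.WhiteRegion ξ), LinkDiagram.signature ξ X₀ = σ) ∧
      ∀ i j : ℤ, Nontrivial (D.Kh i j) → j = 2 * i - σ + 1 ∨ j = 2 * i - σ - 1 := by
  open LinkDiagram in
  refine ⟨_, ?_, signature_eq hconn hclassical halt, fun i j hKh => ?_⟩
  · have hne : Nonempty (Quot D.linked ⊕ Fin D.loops) := (Nat.card_eq_one_iff_unique.1 hconn).2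
    have hp : Nonempty D.Pt := by
      obtain ⟨z | l⟩ := hne
      · exact ⟨Sum.inl (Quot.exists_rep z).choose⟩
      · exact ⟨Sum.inr l⟩
    obtain ⟨p⟩ := hp
    have hξ : IsType (altColoring halt true) true := altColoring_white_corner halt true
    exact ⟨_, ⟨_, white_regionOf halt hξ (D.cl _ p)⟩, signature_eq hconn hclassical halt _ _⟩
  · by_contra hj
    have hfill : ∀ b, fill Finset.univ b (constState D false) = constState D b := fun b => by
      funext c; simp [fill, constState]
    have hones : ones (constState D false) = 0 := by simp [ones, constState]
    refine subsingleton_Kh halt rfl rfl (exactAt_of_connected halt Finset.univ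
      (constState D false) (card_compRel_univ hconn _) ?_ ?_ ?_) hKh
    · rw [hfill, hfill, cycleCount_add_cycleCount halt hclassical, Finset.card_univ,
        Fintype.card_fin]
    · rw [hfill, hones]; omega
    · rw [hfill, hones]; omega
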